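/- **Setting.** Let $(\mathbf Y_i,\mathbf X_i)$, $i=1,2,\dots$, be an i.i.d. sequence, where $\mathbf Y_i=(Y_{i1},\dots,Y_{in})^T\in\mathbb R^n$ has integrable coordinates and $\mathbf X_i=(\mathbf X_{i1},\dots,\mathbf X_{in})$ has columns $\mathbf X_{it}\in\mathbb R^q$. Let $h,v:\mathbb R\to\mathbb R$ be measurable functions (inverse link and variance function), $\phi>0$, and let $\mathbf M_1,\dots,\mathbf M_s$ be fixed real $n\times n$ matrices. Let $\mathcal B\subset\mathbb R^q$ be compact and let $\beta_0$ be an interior point of $\mathcal B$ such that $E(Y_{it}\mid \mathbf X_i)=h(\mathbf X_{it}^T\beta_0)$ almost surely for all $i,t$. Almost surely, for all $\beta\in\mathcal B$ and all $t$, $h$ is differentiable at $\mathbf X_{it}^T\beta$ and $v(\mathbf X_{it}^T\beta)>0$. Put $\mathbf h_i(\beta)=(h(\mathbf X_{i1}^T\beta),\dots,h(\mathbf X_{in}^T\beta))^T$, let $\nabla\mathbf h_i(\beta)$ be its $n\times q$ matrix of partial derivatives in $\beta$, let $\mathbf A_i(\beta)=\mathrm{diag}(\phi\, v(\mathbf X_{i1}^T\beta),\dots,\phi\,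 v(\mathbf X_{in}^T\beta))$, and let $\mathbf g_i(\beta)\in\mathbb R^{qs}$ be the vector obtained by stacking the blocks $$\nabla\mathbf h_i^T\,\mathbf A_i^{-1/2}\,\mathbf M_j\,\mathbf A_i^{-1/2}\,(\mathbf Y_i-\mathbf h_i),\qquad j=1,\dots,s .$$ Define $$\overline{\mathbf g}_N=\frac1N\sum_{i=1}^N\mathbf g_i,\qquad \widehat{\mathbf C}_N=\frac1N\sum_{i=1}^N\mathbf g_i\mathbf g_i^T,\qquad Q_N=N\,\overline{\mathbf g}_N^T\,\widehat{\mathbf C}_N^{-1}\,\overline{\mathbf g}_N,$$ where the Moore–Penrose inverse is used if $\widehat{\mathbf C}_N$ is singular, and $$\mathbf\Sigma(\beta)=E\{\mathbf g_1(\beta)\mathbf g_1(\beta)^T\},\quad \mathbf D(\beta)=E\{\nabla\mathbf g_1(\beta)\},\quad \mathbf J(\beta)=\mathbf D(\beta)^T\mathbf\Sigma(\beta)^{-1}\mathbf D(\beta),\quad \mathbf Z_N=\frac1{2\sqrt N}\nabla Q_N(\beta_0).$$ **Assumptions.** 1. For $\beta\in\mathcal B$, $E\{\mathbf g_1(\beta)\}=0$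 only if $\beta=\beta_0$. 2. $\mathbf\Sigma(\beta)$ is positive definite for every $\beta\in\mathcal B$. 3. Almost surely, each $\mathbf g_i$ is twice continuously differentiable in a neighbourhood of every point of $\mathcal B$ (so its second-order partial derivatives are uniformly continuous on $\mathcal B$). 4. There is an integrable random variable that almost surely bounds, for all $\beta\in\mathcal B$, the entries of $\mathbf g_1(\beta)$ and of $\mathbf g_1(\beta)\mathbf g_1(\beta)^T$ together with their first and second derivatives in $\beta$. 5. $\mathbf J(\beta_0)$ is nonsingular. **Conclusion.** For each $N$ let the QIF estimator $\widehat\beta_N$ be a measurable random vector that almost surely lies in $\mathcal B$ and minimizes $Q_N$ over $\mathcal B$. Then, as $N\to\infty$, $$\sqrt N\,(\widehat\beta_N-\beta_0)\ \overset{d}{\longrightarrow}\ N_q\{0,\mathbf J^{-1}(\beta_0)\}$$ and $$\widehat\beta_N=\beta_0-N^{-1/2}\,\mathbf J^{-1}(\beta_0)\,\mathbf Z_N+o_p(N^{-1/2}).$$ -/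

import Mathlib

open MeasureTheory ProbabilityTheory Filter Topology

noncomputable section

namespace QIF

/-- The partial derivative of `f` at `β` with respect to the `l`-th coordinate. -/
def partialDeriv {q : ℕ} (f : EuclideanSpace ℝ (Fin q) → ℝ) (l : Fin q)
    (β : EuclideanSpace ℝ (Fin q)) : ℝ :=
  fderiv ℝ f β (EuclideanSpace.single l 1)

section SubjectScore

variable {n q s : ℕ}

/-- The mean vector `(h(x₁ᵀβ), …, h(xₙᵀβ))` of a subject with covariates `x₁, …, xₙ`. -/
def meanVec (h : ℝ → ℝ) (x : Fin n → EuclideanSpace ℝ (Fin q))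
    (β : EuclideanSpace ℝ (Fin q)) : Fin n → ℝ :=
  fun t => h (inner ℝ (x t) β)

/-- The `n × q` matrix of partial derivatives of the mean vector with respect to `β`. -/
def meanJacobian (h : ℝ → ℝ) (x : Fin n → EuclideanSpace ℝ (Fin q))
    (β : EuclideanSpace ℝ (Fin q)) : Matrix (Fin n) (Fin q) ℝ :=
  Matrix.of fun t l => partialDeriv (fun b => meanVec h x b t) l β

/-- `A^{-1/2}`, where `A = diag(φ v(x₁ᵀβ), …, φ v(xₙᵀβ))` holds the marginal variances that the
variance function `v` and the dispersion `φ` prescribe. -/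
def invSqrtVar (v : ℝ → ℝ) (φ : ℝ) (x : Fin n → EuclideanSpace ℝ (Fin q))
    (β : EuclideanSpace ℝ (Fin q)) : Matrix (Fin n) (Fin n) ℝ :=
  Matrix.diagonal fun t => (√(φ * v (inner ℝ (x t) β)))⁻¹

/-- The basic score vector of a subject with responses `y` and covariates `x`: the `s` blocks
`(∇h)ᵀ A^{-1/2} Mⱼ A^{-1/2} (y - h)`, each of dimension `q`, stacked. The index `(j, l)` stands
for coordinate `l` of block `j`. -/
def score (h v : ℝ → ℝ) (φ : ℝ) (M : Fin s → Matrix (Fin n) (Fin n) ℝ)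
    (y : Fin n → ℝ) (x : Fin n → EuclideanSpace ℝ (Fin q))
    (β : EuclideanSpace ℝ (Fin q)) : Fin s × Fin q → ℝ :=
  fun p => Matrix.mulVec
    ((meanJacobian h x β).transpose * invSqrtVar v φ x β * M p.1 * invSqrtVar v φ x β)
    (y - meanVec h x β) p.2

end SubjectScore

section PseudoInverse

variable {R : Type*} [Fintype R] [DecidableEq R]

/-- The Moore–Penrose inverse of a real symmetric matrix: every nonzero eigenvalue is inverted and
the eigenvalue `0` is kept (in Lean, `0⁻¹ = 0`). -/
def pinv (C : Matrix R R ℝ) : Matrix R R ℝ :=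
  cfc (fun t : ℝ => t⁻¹) C

theorem mul_pinv_mul (C : Matrix R R ℝ) (hC : C.IsHermitian) : C * pinv C * C = C := by
  have hc : ∀ f : ℝ → ℝ, ContinuousOn f (spectrum ℝ C) := fun f =>
    (Matrix.finite_real_spectrum (A := C)).continuousOn f
  have hs : IsSelfAdjoint C := hC
  have key : cfc (fun x : ℝ => x) C * pinv C * cfc (fun x : ℝ => x) C
      = cfc (fun x : ℝ => x) C := by
    unfold pinv
    rw [← cfc_mul _ _ _ (hc _) (hc _), ← cfc_mul _ _ _ (hc _) (hc _)]
    refine cfc_congr fun x _ => ?_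
    by_cases h : x = 0 <;> simp [h]
  rwa [cfc_id' ℝ C hs] at key

theorem pinv_eq_inv (C : Matrix R R ℝ) (hC : C.IsHermitian) (hu : IsUnit C) :
    pinv C = C⁻¹ := by
  have h := mul_pinv_mul C hC
  have h1 : C * pinv C = 1 := hu.mul_right_cancel (by rw [h, one_mul])
  exact (Matrix.inv_eq_right_inv h1).symm

end PseudoInverse

section InferenceFunction

variable {Ω R : Type*} {q : ℕ}

/-- The extended score `ḡ_N(β) = N⁻¹ ∑ gᵢ(β)`; the subjects are numbered `0, 1, …, N - 1`. -/
def meanScore (g : ℕ → Ω → EuclideanSpace ℝ (Fin q) → R → ℝ) (N : ℕ) (ω : Ω)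
    (β : EuclideanSpace ℝ (Fin q)) : R → ℝ :=
  fun k => (N : ℝ)⁻¹ * ∑ i ∈ Finset.range N, g i ω β k

/-- The sample second moment matrix `Ĉ_N(β) = N⁻¹ ∑ gᵢ(β) gᵢ(β)ᵀ`. -/
def sampleMoment (g : ℕ → Ω → EuclideanSpace ℝ (Fin q) → R → ℝ) (N : ℕ) (ω : Ω)
    (β : EuclideanSpace ℝ (Fin q)) : Matrix R R ℝ :=
  Matrix.of fun k l => (N : ℝ)⁻¹ * ∑ i ∈ Finset.range N, g i ω β k * g i ω β l

/-- The quadratic inference function `Q_N(β) = N ḡ_N(β)ᵀ Ĉ_N(β)⁻¹ ḡ_N(β)`. Where `Ĉ_N(β)` is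
singular its Moore–Penrose inverse is used. -/
def qif [Fintype R] [DecidableEq R] (g : ℕ → Ω → EuclideanSpace ℝ (Fin q) → R → ℝ) (N : ℕ)
    (ω : Ω) (β : EuclideanSpace ℝ (Fin q)) : ℝ :=
  N * dotProduct (meanScore g N ω β)
    (Matrix.mulVec (pinv (sampleMoment g N ω β)) (meanScore g N ω β))

/-- `Z_N = (2 √N)⁻¹ ∇Q_N(β₀)`. -/
def zVec [Fintype R] [DecidableEq R] (g : ℕ → Ω → EuclideanSpace ℝ (Fin q) → R → ℝ)
    (β₀ : EuclideanSpace ℝ (Fin q)) (N : ℕ) (ω : Ω) : EuclideanSpace ℝ (Fin q) :=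
  (2 * √(N : ℝ))⁻¹ • gradient (qif g N ω) β₀

variable [MeasurableSpace Ω]

/-- The second moment matrix `Σ(β) = E[g₁(β) g₁(β)ᵀ]` of one subject's score. -/
def sigma (μ : Measure Ω) (g₁ : Ω → EuclideanSpace ℝ (Fin q) → R → ℝ)
    (β : EuclideanSpace ℝ (Fin q)) : Matrix R R ℝ :=
  Matrix.of fun k l => ∫ ω, g₁ ω β k * g₁ ω β l ∂μ

/-- The matrix `D(β) = E[∇g₁(β)]`. -/
def meanDeriv (μ : Measure Ω) (g₁ : Ω → EuclideanSpace ℝ (Fin q) → R → ℝ)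
    (β : EuclideanSpace ℝ (Fin q)) : Matrix R (Fin q) ℝ :=
  Matrix.of fun k l => ∫ ω, partialDeriv (fun b => g₁ ω b k) l β ∂μ

/-- The matrix `J(β) = D(β)ᵀ Σ(β)⁻¹ D(β)`. -/
def infoMatrix [Fintype R] [DecidableEq R] (μ : Measure Ω)
    (g₁ : Ω → EuclideanSpace ℝ (Fin q) → R → ℝ)
    (β : EuclideanSpace ℝ (Fin q)) : Matrix (Fin q) (Fin q) ℝ :=
  (meanDeriv μ g₁ β).transpose * (sigma μ g₁ β)⁻¹ * meanDeriv μ g₁ β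

end InferenceFunction

end QIF

end

/-! Write G for the mean score, C for the sample moment matrix, m and Σ for their limits and K =
J⁻¹DᵀΣ⁻¹. The argument is almost sure and deterministic up to its last step, where probability
enters through a central limit theorem.

The strong law in the Banach space C(B, ℝ) makes G, C and their first partial derivatives converge
uniformly on B (`contConvOn_mean`). Hence GᵀC⁻¹G converges to mᵀΣ⁻¹m, which is positive except at
β₀, and compactness of B forces the minimizers to converge to β₀ (`tendsto_minimizer`).

The gradient of GᵀC⁻¹G factors as L G, where L depends only on G, C and their first derivatives
(`gradFactor`). Since m(β₀) = 0, L tends to 2DᵀΣ⁻¹ along any sequence tending to β₀. Eventually the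
minimizer b is interior to B, so L G(b) = 0; the mean value expansion G(b) = G(β₀) + D_N (b - β₀)
turns this into b - β₀ = -(L D_N)⁻¹ L G(β₀) = -K G(β₀) + o(G(β₀)) (`isLittleO_minimizer`). The same
factorization at β₀ gives ½ J⁻¹ L G(β₀) = K G(β₀) + o(G(β₀)), which is the term with Z_N
(`isLittleO_gradFactor`).

The score has mean zero at β₀ (`integral_score_eq_zero`), so √N G(β₀) is asymptotically N(0, Σ), in
particular tight. Tightness turns the almost sure o(G(β₀)), multiplied by √N, into o_p(1)
(`tendstoInMeasure_of_isLittleO`). Slutsky's lemma and KΣKᵀ = J⁻¹ (`sandwich_eq`) conclude. -/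

namespace QIF

open scoped Matrix

/-! ### Uniform strong law on a compact set -/

section UniformLaw

variable {Ω 𝒳 E : Type*} [MeasurableSpace Ω] [MeasurableSpace 𝒳] [MetricSpace E]

/-- Continuous convergence on `B`: `A N (b N) → a β` whenever `b N → β` inside `B`, along every
filter on `ℕ` finer than `atTop`. -/
def ContConvOn (A : ℕ → E → ℝ) (a : E → ℝ) (B : Set E) : Prop :=
  ∀ l : Filter ℕ, l ≤ atTop → ∀ b : ℕ → E, ∀ β ∈ B, (∀ᶠ N in l, b N ∈ B) → Tendsto b l (𝓝 β) →
    Tendsto (fun N => A N (b N)) l (𝓝 (a β))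

/-- A function of the data that is measurable at every point of `B` factors measurably through
`C(B, ℝ)`, at the data for which it is continuous on `B`. -/
theorem exists_measurable_continuousMap {B : Set E} (hB : IsCompact B) (f : 𝒳 → E → ℝ)
    (hf : ∀ β ∈ B, Measurable fun x => f x β) [MeasurableSpace C(B, ℝ)] [BorelSpace C(B, ℝ)] :
    ∃ Φ : 𝒳 → C(B, ℝ), Measurable Φ ∧ ∀ x, ContinuousOn (f x) B → ∀ β : B, Φ x β = f x β := by
  have : CompactSpace B := isCompact_iff_compactSpace.mp hB
  obtain ⟨D, hDc, hDd⟩ := TopologicalSpace.exists_countable_dense B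
  have : Countable D := hDc.to_subtype
  let ι : C(B, ℝ) → (D → ℝ) := fun F d => F d
  have hιc : Continuous ι := continuous_pi fun d => continuous_eval_const _
  have hιi : Function.Injective ι := by
    intro F G h
    ext β
    have : Set.EqOn F G D := fun d hd => congrFun h ⟨d, hd⟩
    exact congrFun (Continuous.ext_on hDd F.continuous G.continuous this) β
  -- By the Lusin–Souslin theorem, the continuous injection `ι` of a Polish space is a measurable
  -- embedding, so it has a measurable left inverse `ρ`. Composing `ρ` with the evaluations on the
  -- countable dense set gives `Φ`, even though the data may be discontinuous for some `x`.
  obtain ⟨ρ, hρ, hρι⟩ := (hιc.measurableEmbedding hιi).exists_measurable_extend measurable_id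
    fun _ => ⟨0⟩
  refine ⟨fun x => ρ fun d => f x d, hρ.comp (measurable_pi_lambda _ fun d => hf _ d.1.2), ?_⟩
  intro x hx β
  have h1 : (fun d : D => f x d) = ι ⟨B.domRestrict (f x), hx.domRestrict⟩ := rfl
  have h2 := congrFun hρι ⟨B.domRestrict (f x), hx.domRestrict⟩
  simp only [Function.comp_apply, id] at h2
  simp only [h1, h2]
  rfl

/-- Uniform law of large numbers on a compact set, for an i.i.d. sequence of random functions with
an integrable envelope. -/
theorem contConvOn_mean {μ : Measure Ω} [IsProbabilityMeasure μ] {B : Set E} (hB : IsCompact B)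
    {d : ℕ → Ω → 𝒳} (hd : ∀ i, Measurable (d i)) (hindep : iIndepFun d μ)
    (hident : ∀ i, IdentDistrib (d i) (d 0) μ μ)
    {g : ℕ → Ω → E → ℝ} (f : 𝒳 → E → ℝ) (hf : ∀ β ∈ B, Measurable fun x => f x β)
    (hgf : ∀ i, ∀ᵐ ω ∂μ, ∀ β ∈ B, g i ω β = f (d i ω) β)
    (hc : ∀ i, ∀ᵐ ω ∂μ, ContinuousOn (g i ω) B)
    {b : Ω → ℝ} (hb : Integrable b μ) (hgb : ∀ᵐ ω ∂μ, ∀ β ∈ B, |g 0 ω β| ≤ b ω) :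
    ∀ᵐ ω ∂μ, ContConvOn (fun N β => (N : ℝ)⁻¹ * ∑ i ∈ Finset.range N, g i ω β)
      (fun β => ∫ ω, g 0 ω β ∂μ) B := by
  have : CompactSpace B := isCompact_iff_compactSpace.mp hB
  rcases B.eq_empty_or_nonempty with rfl | hne
  · exact .of_forall fun ω l _ b' β hβ => hβ.elim
  have : Nonempty B := hne.to_subtype
  borelize C(B, ℝ)
  obtain ⟨Φ, hΦ, hΦf⟩ := exists_measurable_continuousMap hB f hf
  have hX : ∀ i, ∀ᵐ ω ∂μ, ∀ β : B, Φ (d i ω) β = g i ω β := fun i => by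
    filter_upwards [hgf i, hc i] with ω h1 h2 β
    rw [hΦf _ _ β, h1 _ β.2]
    exact h2.congr fun β hβ => (h1 β hβ).symm
  have hint : Integrable (fun ω => Φ (d 0 ω)) μ := by
    refine hb.mono' (hΦ.comp (hd 0)).aestronglyMeasurable ?_
    filter_upwards [hX 0, hgb] with ω h1 h2
    refine (ContinuousMap.norm_le_of_nonempty _).2 fun β => ?_
    rw [h1]
    exact h2 _ β.2
  have hSL := strong_law_ae (fun i ω => Φ (d i ω)) hint
    (fun i j hij => (hindep.indepFun hij).comp hΦ hΦ) (fun i => (hident i).comp hΦ)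
  filter_upwards [hSL, ae_all_iff.2 hX] with ω h1 h2
  intro l hl b' β hβ hmem hlim
  classical
  -- The points outside B are replaced by β; along `l` this changes nothing eventually.
  let c : ℕ → B := fun N => if h : b' N ∈ B then ⟨b' N, h⟩ else ⟨β, hβ⟩
  have hcb : ∀ᶠ N in l, (c N : E) = b' N := by
    filter_upwards [hmem] with N hN
    simp [c, hN]
  have hclim : Tendsto c l (𝓝 ⟨β, hβ⟩) := by
    rw [tendsto_subtype_rng]
    exact hlim.congr' (hcb.mono fun N hN => hN.symm)
  -- Evaluation is jointly continuous on C(B, ℝ) × B because B is compact, so norm convergence gives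
  -- continuous convergence.
  have h3 := (h1.mono_left hl).eval hclim
  have h4 : (∫ ω, Φ (d 0 ω) ∂μ) ⟨β, hβ⟩ = ∫ ω, g 0 ω β ∂μ := by
    rw [ContinuousMap.integral_apply hint]
    refine integral_congr_ae ?_
    filter_upwards [hX 0] with ω hω
    exact hω _
  rw [show (fun β => ∫ ω, g 0 ω β ∂μ) β = _ from h4.symm]
  refine h3.congr' ?_
  filter_upwards [hcb] with N hN
  simp only [ContinuousMap.smul_apply, ContinuousMap.sum_apply, h2, hN, smul_eq_mul]

end UniformLaw

/-! ### Stochastic order symbols, tightness and the central limit theorem -/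

section Stochastic

variable {Ω : Type*} [MeasurableSpace Ω] {μ : Measure Ω} [IsProbabilityMeasure μ]

/-- If `V = o(S)` almost surely and `S` is tight, then `V` tends to `0` in probability. -/
theorem tendstoInMeasure_of_isLittleO {F G : Type*} [NormedAddCommGroup F] [MeasurableSpace F]
    [BorelSpace F] [NormedAddCommGroup G] [MeasurableSpace G] [BorelSpace G]
    {V : ℕ → Ω → F} {S : ℕ → Ω → G} (hV : ∀ N, AEMeasurable (V N) μ)
    (hS : ∀ N, AEMeasurable (S N) μ) (ht : IsTightMeasureSet (Set.range fun N => μ.map (S N)))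
    (ho : ∀ᵐ ω ∂μ, (fun N => V N ω) =o[atTop] (fun N => S N ω)) :
    TendstoInMeasure μ V atTop (fun _ => 0) := by
  -- The ratio tends to 0 almost surely, and ‖V‖ ≤ (1 + r) ρ where ‖S‖ ≤ r. The summand 1 keeps the
  -- denominator away from 0.
  set ρ : ℕ → Ω → ℝ := fun N ω => ‖V N ω‖ / (1 + ‖S N ω‖) with hρ
  have hρm : ∀ N, AEMeasurable (ρ N) μ := fun N => (hV N).norm.div ((hS N).norm.const_add 1)
  have hρ0 : TendstoInMeasure μ ρ atTop (fun _ => 0) := by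
    refine tendstoInMeasure_of_tendsto_ae (fun N => (hρm N).aestronglyMeasurable) ?_
    filter_upwards [ho] with ω hω
    rw [Metric.tendsto_nhds]
    intro ε hε
    filter_upwards [hω.bound (half_pos hε)] with N hN
    have h0 := norm_nonneg (S N ω)
    have h1 := norm_nonneg (V N ω)
    rw [Real.dist_eq, sub_zero, abs_of_nonneg (by positivity), div_lt_iff₀ (by positivity)]
    nlinarith
  rw [tendstoInMeasure_iff_norm] at hρ0 ⊢
  intro ε hε
  rw [ENNReal.tendsto_nhds_zero]
  intro δ hδ
  have hδ2 : 0 < δ / 2 := ENNReal.half_pos hδ.ne'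
  obtain ⟨r, hr0, hr⟩ : ∃ r : ℝ, 0 < r ∧
      ⨆ ν ∈ Set.range (fun N => μ.map (S N)), ν {x | r < ‖x‖} ≤ δ / 2 :=
    ((eventually_gt_atTop 0).and ((ENNReal.tendsto_nhds_zero.1
      (tendsto_measure_norm_gt_of_isTightMeasureSet ht)) _ hδ2)).exists
  have hSr : ∀ N, μ {ω | r < ‖S N ω‖} ≤ δ / 2 := fun N => by
    have h1 := (le_iSup₂ (f := fun ν (_ : ν ∈ Set.range (fun N => μ.map (S N))) =>
      ν {x : G | r < ‖x‖}) (μ.map (S N)) ⟨N, rfl⟩).trans hr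
    rwa [Measure.map_apply_of_aemeasurable (hS N)
      (measurableSet_lt measurable_const measurable_norm)] at h1
  have hε' : 0 < ε / (1 + r) := by positivity
  filter_upwards [ENNReal.tendsto_nhds_zero.1 (hρ0 _ hε') _ hδ2] with N hN
  calc μ {x | ε ≤ ‖V N x - 0‖}
      ≤ μ ({x | ε / (1 + r) ≤ ‖ρ N x - 0‖} ∪ {ω | r < ‖S N ω‖}) := by
        refine measure_mono fun ω hω => ?_
        by_cases h : r < ‖S N ω‖
        · exact Or.inr h
        · left
          simp only [Set.mem_ofPred_eq, sub_zero] at hω ⊢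
          have h0 := norm_nonneg (S N ω)
          rw [Real.norm_of_nonneg (by positivity)]
          exact div_le_div₀ (norm_nonneg _) hω (by positivity) (by linarith)
    _ ≤ δ / 2 + δ / 2 := (measure_union_le _ _).trans (add_le_add hN (hSr N))
    _ = δ := ENNReal.add_halves δ

/-- The characteristic functions converge to one that is continuous at 0, which forces tightness. -/
theorem _root_.MeasureTheory.TendstoInDistribution.isTightMeasureSet_range {E : Type*}
    [NormedAddCommGroup E] [InnerProductSpace ℝ E] [FiniteDimensional ℝ E] [MeasurableSpace E]
    [BorelSpace E] {Ω' : Type*} [MeasurableSpace Ω'] {ν : Measure Ω'} [IsProbabilityMeasure ν]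
    {S : ℕ → Ω → E} {Z : Ω' → E} (h : TendstoInDistribution S atTop Z (fun _ => μ) ν) :
    IsTightMeasureSet (Set.range fun N => μ.map (S N)) := by
  have := fun N => Measure.isProbabilityMeasure_map (μ := μ) (h.forall_aemeasurable N)
  have := Measure.isProbabilityMeasure_map (μ := ν) h.aemeasurable_limit
  exact isTightMeasureSet_of_tendsto_charFun (f := charFun (ν.map Z)) (by fun_prop)
    (ProbabilityMeasure.tendsto_iff_tendsto_charFun.1 h.tendsto)

/-- Central limit theorem for centred square integrable random vectors. -/
theorem tendstoInDistribution_multivariate {ι : Type*} [Fintype ι] [DecidableEq ι]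
    {X : ℕ → Ω → EuclideanSpace ℝ ι} (hX : ∀ i, Measurable (X i)) (hindep : iIndepFun X μ)
    (hident : ∀ i, IdentDistrib (X i) (X 0) μ μ) (h2 : ∀ k, MemLp (fun ω => X 0 ω k) 2 μ)
    (h0 : ∀ k, ∫ ω, X 0 ω k ∂μ = 0) {S : Matrix ι ι ℝ} (hS : S.PosSemidef)
    (hcov : ∀ k l, ∫ ω, X 0 ω k * X 0 ω l ∂μ = S k l) :
    TendstoInDistribution (fun (N : ℕ) ω => (√(N : ℝ))⁻¹ • ∑ i ∈ Finset.range N, X i ω) atTop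
      (id : EuclideanSpace ℝ ι → EuclideanSpace ℝ ι) (fun _ => μ) (multivariateGaussian 0 S) where
  forall_aemeasurable N := by
    have : Measurable fun ω => (√(N : ℝ))⁻¹ • ∑ i ∈ Finset.range N, X i ω := by fun_prop
    exact this.aemeasurable
  tendsto := by
    refine ProbabilityMeasure.tendsto_iff_tendsto_charFun.2 fun t => ?_
    simp only [ProbabilityMeasure.coe_mk, Measure.map_id]
    -- Cramér–Wold: the characteristic function at `t` is that of the projection on `t`, evaluated
    -- at 1, and the scalar theorem applies to the projection.
    let L : EuclideanSpace ℝ ι → ℝ := fun x => inner ℝ x t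
    have hL : Continuous L := by fun_prop
    have hLX : ∀ ω, L (X 0 ω) = ∑ k, t k * X 0 ω k := fun ω => by
      simp [L, PiLp.inner_apply]
    have hmem : MemLp (fun ω => L (X 0 ω)) 2 μ := by
      simp only [hLX]
      exact memLp_finsetSum _ fun k _ => (h2 k).const_mul _
    have hint : ∀ k, Integrable (fun ω => X 0 ω k) μ := fun k => (h2 k).integrable (by norm_num)
    have hL0 : ∫ ω, L (X 0 ω) ∂μ = 0 := by
      simp only [hLX]
      rw [integral_finsetSum _ fun k _ => (hint k).const_mul _]
      simp [integral_const_mul, h0]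
    have hvar : Var[fun ω => L (X 0 ω); μ] = t ⬝ᵥ S.mulVec t := by
      rw [variance_of_integral_eq_zero (X := fun ω => L (X 0 ω))
        (hL.measurable.comp (hX 0)).aemeasurable hL0]
      have h3 : ∀ ω, L (X 0 ω) ^ 2 = ∑ k, ∑ l, t k * t l * (X 0 ω k * X 0 ω l) := fun ω => by
        rw [hLX, sq, Finset.sum_mul_sum]
        exact Finset.sum_congr rfl fun k _ => Finset.sum_congr rfl fun l _ => by ring
      have hint2 : ∀ k l, Integrable (fun ω => X 0 ω k * X 0 ω l) μ := fun k l =>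
        (h2 k).integrable_mul (h2 l)
      simp only [h3]
      rw [integral_finsetSum _ fun k _ => integrable_finsetSum _ fun l _ =>
        (hint2 k l).const_mul _]
      refine Finset.sum_congr rfl fun k _ => ?_
      rw [integral_finsetSum _ fun l _ => (hint2 k l).const_mul _]
      simp only [integral_const_mul, hcov, Matrix.mulVec, dotProduct, Finset.mul_sum]
      exact Finset.sum_congr rfl fun l _ => by ring
    have hclt := tendstoInDistribution_inv_sqrt_mul_sum_sub (P := μ)
      (X := fun i ω => L (X i ω)) (Y := id)
      (P' := gaussianReal 0 Var[fun ω => L (X 0 ω); μ].toNNReal)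
      ⟨aemeasurable_id, Measure.map_id⟩ hmem (hindep.comp (fun _ => L) fun _ => hL.measurable)
      (fun i => (hident i).comp hL.measurable)
    have h4 := ProbabilityMeasure.tendsto_iff_tendsto_charFun.1 hclt.tendsto 1
    simp only [ProbabilityMeasure.coe_mk, Measure.map_id, hL0, mul_zero, sub_zero] at h4
    rw [charFun_gaussianReal, hvar] at h4
    rw [charFun_multivariateGaussian hS]
    have h5 : 0 ≤ t ⬝ᵥ S.mulVec t := by simpa using hS.dotProduct_mulVec_nonneg t
    convert h4 using 1
    · ext N
      rw [charFun_apply, charFun_apply, integral_map, integral_map]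
      · refine integral_congr_ae (.of_forall fun ω => ?_)
        simp [L, inner_smul_left, sum_inner]
      all_goals fun_prop
    · simp [Real.coe_toNNReal _ h5]

end Stochastic

/-! ### Measurability of the score in the data -/

section Measurability

variable {𝒳 : Type*} [MeasurableSpace 𝒳] {n q s : ℕ}

theorem tendsto_partialDeriv {f : EuclideanSpace ℝ (Fin q) → ℝ} {β : EuclideanSpace ℝ (Fin q)}
    (hf : DifferentiableAt ℝ f β) (l : Fin q) :
    Tendsto (fun m : ℕ => (m : ℝ) • (f (β + (m : ℝ)⁻¹ • EuclideanSpace.single l 1) - f β)) atTop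
      (𝓝 (partialDeriv f l β)) :=
  hf.hasFDerivAt.lim _ (tendsto_norm_atTop_atTop.comp tendsto_natCast_atTop_atTop)

/-- The partial derivative of a random function is measurable, where it exists. -/
theorem exists_measurable_partialDeriv {f : 𝒳 → EuclideanSpace ℝ (Fin q) → ℝ}
    (hf : ∀ β, Measurable fun x => f x β) (l : Fin q) :
    ∃ f' : 𝒳 → EuclideanSpace ℝ (Fin q) → ℝ, (∀ β, Measurable fun x => f' x β) ∧
      ∀ x β, DifferentiableAt ℝ (f x) β → partialDeriv (f x) l β = f' x β := by
  refine ⟨fun x β => limUnder atTop fun m : ℕ =>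
    (m : ℝ) • (f x (β + (m : ℝ)⁻¹ • EuclideanSpace.single l 1) - f x β), fun β => ?_,
    fun x β hx => (tendsto_partialDeriv hx l).limUnder_eq.symm⟩
  exact (StronglyMeasurable.limUnder fun m : ℕ =>
    (((hf _).sub (hf _)).const_smul (m : ℝ)).stronglyMeasurable).measurable

/-- No differentiability of `h` is required, because both sides take the default value 0 together.
This makes the mean Jacobian measurable in the covariates through `measurable_deriv`. -/
theorem partialDeriv_comp_inner (h : ℝ → ℝ) (x : EuclideanSpace ℝ (Fin q)) (l : Fin q)
    (β : EuclideanSpace ℝ (Fin q)) :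
    partialDeriv (fun b => h (inner ℝ x b)) l β = deriv h (inner ℝ x β) * x l := by
  unfold partialDeriv
  by_cases hd : DifferentiableAt ℝ h (inner ℝ x β)
  · have h1 : HasFDerivAt (fun b => inner ℝ x b) (innerSL ℝ x) β := (innerSL ℝ x).hasFDerivAt
    have h2 := hd.hasDerivAt.comp_hasFDerivAt β h1
    rw [show (fun b => h (inner ℝ x b)) = h ∘ fun b => inner ℝ x b from rfl, h2.fderiv]
    simp [EuclideanSpace.inner_single_right]
  · rw [deriv_zero_of_not_differentiableAt hd, zero_mul]
    rcases eq_or_ne x 0 with rfl | hx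
    · simp
    · rw [fderiv_zero_of_not_differentiableAt, zero_apply]
      intro hc
      refine hd ?_
      have hx' : inner ℝ x x ≠ 0 := inner_self_ne_zero.2 hx
      -- Along this line in direction `x` the inner product with `x` equals `u`, so
      -- differentiability of the composite at β would give differentiability of `h`.
      have h3 : DifferentiableAt ℝ (fun u : ℝ => β + ((u - inner ℝ x β) / inner ℝ x x) • x)
          (inner ℝ x β) := by fun_prop
      have h4 := DifferentiableAt.comp (inner ℝ x β)
        (g := fun b => h (inner ℝ x b)) (by simpa using hc) h3
      have h5 : ((fun b => h (inner ℝ x b)) ∘ fun u : ℝ =>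
          β + ((u - inner ℝ x β) / inner ℝ x x) • x) = h := by
        ext u
        simp only [Function.comp_apply, inner_add_right, inner_smul_right]
        congr 1
        field_simp
        ring
      rwa [h5] at h4

theorem measurable_scoreWeight {h v : ℝ → ℝ} (hv : Measurable v) (φ : ℝ)
    (M : Matrix (Fin n) (Fin n) ℝ) (β : EuclideanSpace ℝ (Fin q)) (l : Fin q) (t : Fin n) :
    Measurable fun x : Fin n → EuclideanSpace ℝ (Fin q) =>
      ((meanJacobian h x β).transpose * invSqrtVar v φ x β * M * invSqrtVar v φ x β) l t := by
  have hm := measurable_deriv h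
  simp only [Matrix.mul_apply, invSqrtVar, meanJacobian, Matrix.transpose_apply, Matrix.of_apply,
    meanVec, partialDeriv_comp_inner, Matrix.diagonal_apply]
  have hin : ∀ t, Measurable fun x : Fin n → EuclideanSpace ℝ (Fin q) => inner ℝ (x t) β :=
    fun t => by fun_prop
  have h1 := fun t => hm.comp (hin t)
  have h3 := fun t => ((hv.comp (hin t)).const_mul φ).sqrt.inv
  simp only [Function.comp_def] at h1 h3
  refine Finset.measurable_fun_sum _ fun t _ => ?_
  refine Measurable.mul (Finset.measurable_fun_sum _ fun t _ => ?_) ?_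
  · refine Measurable.mul_const (Finset.measurable_fun_sum _ fun t _ => ?_) _
    refine Measurable.mul (by have := h1 t; fun_prop) ?_
    split_ifs
    · exact h3 _
    · exact measurable_const
  · split_ifs
    · exact h3 _
    · exact measurable_const

theorem measurable_score {h v : ℝ → ℝ} (hh : Measurable h) (hv : Measurable v) (φ : ℝ)
    (M : Fin s → Matrix (Fin n) (Fin n) ℝ) (β : EuclideanSpace ℝ (Fin q)) (k : Fin s × Fin q) :
    Measurable fun d : (Fin n → ℝ) × (Fin n → EuclideanSpace ℝ (Fin q)) =>
      score h v φ M d.1 d.2 β k := by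
  have h1 : ∀ t, Measurable fun d : (Fin n → ℝ) × (Fin n → EuclideanSpace ℝ (Fin q)) =>
      ((meanJacobian h d.2 β).transpose * invSqrtVar v φ d.2 β * M k.1 * invSqrtVar v φ d.2 β)
        k.2 t := fun t => (measurable_scoreWeight hv φ (M k.1) β k.2 t).comp measurable_snd
  have h2 : ∀ t, Measurable fun d : (Fin n → ℝ) × (Fin n → EuclideanSpace ℝ (Fin q)) =>
    (d.1 - meanVec h d.2 β) t := fun t => by
    have := hh.comp (show Measurable fun d : (Fin n → ℝ) × (Fin n → EuclideanSpace ℝ (Fin q)) =>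
      inner ℝ (d.2 t) β by fun_prop)
    exact ((measurable_pi_apply t).comp measurable_fst).sub this
  simp only [score, Matrix.mulVec, dotProduct]
  exact Finset.measurable_fun_sum _ fun t _ => (h1 t).mul (h2 t)

end Measurability

/-! ### The gradient of the quadratic form GᵀC⁻¹G -/

section Calculus

variable {q : ℕ} {R : Type*} [Fintype R] [DecidableEq R]

theorem gradient_apply_eq_partialDeriv (f : EuclideanSpace ℝ (Fin q) → ℝ)
    (β : EuclideanSpace ℝ (Fin q)) (l : Fin q) : gradient f β l = partialDeriv f l β := by
  have h1 : inner ℝ (gradient f β) (EuclideanSpace.single l (1 : ℝ)) = partialDeriv f l β := by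
    unfold gradient partialDeriv
    simp
  rw [← h1, EuclideanSpace.inner_single_right]
  simp

theorem differentiableAt_det {F : Type*} [NormedAddCommGroup F] [NormedSpace ℝ F]
    {C : F → Matrix R R ℝ} {β : F} (hC : ∀ k l, DifferentiableAt ℝ (fun b => C b k l) β) :
    DifferentiableAt ℝ (fun b => (C b).det) β := by
  simp only [Matrix.det_apply']
  exact DifferentiableAt.fun_sum fun σ _ =>
    (HasFDerivAt.finsetProd fun i _ => (hC _ _).hasFDerivAt).differentiableAt.const_mul _

theorem differentiableAt_inv_apply {F : Type*} [NormedAddCommGroup F] [NormedSpace ℝ F]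
    {C : F → Matrix R R ℝ} {β : F} (hC : ∀ k l, DifferentiableAt ℝ (fun b => C b k l) β)
    (hu : IsUnit (C β)) (k l : R) : DifferentiableAt ℝ (fun b => (C b)⁻¹ k l) β := by
  have hd : (C β).det ≠ 0 := ((Matrix.isUnit_iff_isUnit_det _).1 hu).ne_zero
  simp only [Matrix.inv_def, Matrix.smul_apply, Matrix.adjugate_apply, Ring.inverse_eq_inv',
    smul_eq_mul]
  refine ((differentiableAt_det hC).inv hd).mul (differentiableAt_det fun i j => ?_)
  -- Row `l` of the matrix in Cramer's rule is a constant unit vector; the other rows are those of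
  -- `C`.
  by_cases hi : i = l
  · subst hi
    simp
  · simpa [Matrix.updateRow_ne hi] using hC i j

theorem isUnit_eventually_of_tendsto {α : Type*} {l : Filter α} {C : α → Matrix R R ℝ}
    {S : Matrix R R ℝ} (hC : Tendsto C l (𝓝 S)) (hS : IsUnit S) : ∀ᶠ a in l, IsUnit (C a) := by
  have h1 : Tendsto (fun a => (C a).det) l (𝓝 S.det) :=
    (continuous_id.matrix_det.tendsto S).comp hC
  filter_upwards [h1.eventually_ne ((Matrix.isUnit_iff_isUnit_det _).1 hS).ne_zero] with a ha
  exact (Matrix.isUnit_iff_isUnit_det _).2 (isUnit_iff_ne_zero.2 ha)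

theorem tendsto_matrix_inv {α : Type*} {l : Filter α} {C : α → Matrix R R ℝ}
    {S : Matrix R R ℝ} (hC : Tendsto C l (𝓝 S)) (hS : IsUnit S) :
    Tendsto (fun a => (C a)⁻¹) l (𝓝 S⁻¹) := by
  have hd : S.det ≠ 0 := ((Matrix.isUnit_iff_isUnit_det _).1 hS).ne_zero
  refine (continuousAt_matrix_inv S ?_).tendsto.comp hC
  rw [Ring.inverse_eq_inv']
  exact continuousAt_inv₀ hd

theorem tendsto_matrix_mul {α m n p : Type*} [Fintype n] {l : Filter α} {A : α → Matrix m n ℝ}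
    {A₀ : Matrix m n ℝ} {B : α → Matrix n p ℝ} {B₀ : Matrix n p ℝ} (hA : Tendsto A l (𝓝 A₀))
    (hB : Tendsto B l (𝓝 B₀)) : Tendsto (fun a => A a * B a) l (𝓝 (A₀ * B₀)) :=
  ((continuous_fst.matrix_mul continuous_snd).tendsto (A₀, B₀)).comp (hA.prodMk_nhds hB)

theorem tendsto_matrix_mulVec {α m n : Type*} [Fintype n] {l : Filter α} {A : α → Matrix m n ℝ}
    {A₀ : Matrix m n ℝ} {y : α → n → ℝ} {y₀ : n → ℝ} (hA : Tendsto A l (𝓝 A₀))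
    (hy : Tendsto y l (𝓝 y₀)) : Tendsto (fun a => A a *ᵥ y a) l (𝓝 (A₀ *ᵥ y₀)) :=
  ((continuous_fst.matrix_mulVec continuous_snd).tendsto (A₀, y₀)).comp (hA.prodMk_nhds hy)

theorem tendsto_matrix_vecMul {α m n : Type*} [Fintype m] {l : Filter α} {A : α → Matrix m n ℝ}
    {A₀ : Matrix m n ℝ} {y : α → m → ℝ} {y₀ : m → ℝ} (hy : Tendsto y l (𝓝 y₀))
    (hA : Tendsto A l (𝓝 A₀)) : Tendsto (fun a => y a ᵥ* A a) l (𝓝 (y₀ ᵥ* A₀)) :=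
  ((continuous_fst.matrix_vecMul continuous_snd).tendsto (y₀, A₀)).comp (hy.prodMk_nhds hA)

/-- The matrix `L` for which the gradient of `Gᵀ C⁻¹ G` equals `L G`, in terms of the values `G`,
`C` and of their derivatives `G'`, `C'`. -/
noncomputable def gradFactor (G : R → ℝ) (G' : Matrix R (Fin q) ℝ) (C : Matrix R R ℝ)
    (C' : Fin q → Matrix R R ℝ) : Matrix (Fin q) R ℝ :=
  (2 : ℝ) • (G'ᵀ * C⁻¹) - Matrix.of (fun l => (C⁻¹ *ᵥ G) ᵥ* C' l) * C⁻¹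

theorem tendsto_gradFactor {α : Type*} {l : Filter α} {G : α → R → ℝ} {G₀ : R → ℝ}
    {G' : α → Matrix R (Fin q) ℝ} {G'₀ : Matrix R (Fin q) ℝ} {C : α → Matrix R R ℝ}
    {C₀ : Matrix R R ℝ} {C' : α → Fin q → Matrix R R ℝ} {C'₀ : Fin q → Matrix R R ℝ}
    (hG : Tendsto G l (𝓝 G₀)) (hG' : Tendsto G' l (𝓝 G'₀)) (hC : Tendsto C l (𝓝 C₀))
    (hC' : Tendsto C' l (𝓝 C'₀)) (hu : IsUnit C₀) :
    Tendsto (fun a => gradFactor (G a) (G' a) (C a) (C' a)) l (𝓝 (gradFactor G₀ G'₀ C₀ C'₀)) := by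
  have hI := tendsto_matrix_inv hC hu
  refine ((tendsto_matrix_mul ?_ hI).const_smul (2 : ℝ)).sub (tendsto_matrix_mul ?_ hI)
  · exact (continuous_id.matrix_transpose.tendsto _).comp hG'
  · exact tendsto_pi_nhds.2 fun i =>
      tendsto_matrix_vecMul (tendsto_matrix_mulVec hI hG) (tendsto_pi_nhds.1 hC' i)

theorem gradFactor_zero (G' : Matrix R (Fin q) ℝ) (C : Matrix R R ℝ)
    (C' : Fin q → Matrix R R ℝ) : gradFactor 0 G' C C' = (2 : ℝ) • (G'ᵀ * C⁻¹) := by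
  ext
  simp [gradFactor, Matrix.mul_apply]

/-- The Jacobian matrix of a map into `R → ℝ`. -/
noncomputable def jacobian (G : EuclideanSpace ℝ (Fin q) → R → ℝ) (β : EuclideanSpace ℝ (Fin q)) :
    Matrix R (Fin q) ℝ :=
  Matrix.of fun k l => partialDeriv (fun b => G b k) l β

/-- The entrywise partial derivatives of a matrix valued map. -/
noncomputable def matrixDeriv (C : EuclideanSpace ℝ (Fin q) → Matrix R R ℝ)
    (β : EuclideanSpace ℝ (Fin q)) : Fin q → Matrix R R ℝ :=
  fun l => Matrix.of fun i j => partialDeriv (fun b => C b i j) l β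

/-- Put w = C⁻¹G. Differentiating C w = G gives C w' = G' - C'w, and the symmetry of C gives G·w' =
w·(C w') = w·G' - wᵀC'w. Adding G'·w yields the formula without an explicit derivative of the
inverse. The pseudoinverse is the inverse near β, since invertibility is an open condition. -/
theorem hasFDerivAt_quadForm {F : Type*} [NormedAddCommGroup F] [NormedSpace ℝ F]
    {G : F → R → ℝ} {C : F → Matrix R R ℝ} {β : F}
    (hG : ∀ k, DifferentiableAt ℝ (fun b => G b k) β)
    (hC : ∀ k l, DifferentiableAt ℝ (fun b => C b k l) β)
    (hs : ∀ b, (C b).IsHermitian) (hu : IsUnit (C β)) :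
    DifferentiableAt ℝ (fun b => G b ⬝ᵥ (pinv (C b) *ᵥ G b)) β ∧
    ∀ e, fderiv ℝ (fun b => G b ⬝ᵥ (pinv (C b) *ᵥ G b)) β e =
      2 * ∑ k, fderiv ℝ (fun b => G b k) β e * ((C β)⁻¹ *ᵥ G β) k -
      ∑ k, ∑ l, ((C β)⁻¹ *ᵥ G β) k * fderiv ℝ (fun b => C b k l) β e * ((C β)⁻¹ *ᵥ G β) l := by
  set w : F → R → ℝ := fun b => (C b)⁻¹ *ᵥ G b with hw
  have hwd : ∀ k, DifferentiableAt ℝ (fun b => w b k) β := fun k => by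
    simp only [hw, Matrix.mulVec, dotProduct]
    exact DifferentiableAt.fun_sum fun l _ => (differentiableAt_inv_apply hC hu k l).mul (hG l)
  have hun : ∀ᶠ b in 𝓝 β, IsUnit (C b) :=
    isUnit_eventually_of_tendsto (tendsto_pi_nhds.2 fun k => tendsto_pi_nhds.2 fun l =>
      (hC k l).continuousAt) hu
  have heq : (fun b => G b ⬝ᵥ (pinv (C b) *ᵥ G b)) =ᶠ[𝓝 β] fun b => ∑ k, G b k * w b k := by
    filter_upwards [hun] with b hb
    rw [pinv_eq_inv _ (hs b) hb]
    rfl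
  have hCw : ∀ k, (fun b => ∑ l, C b k l * w b l) =ᶠ[𝓝 β] fun b => G b k := fun k => by
    filter_upwards [hun] with b hb
    have : C b *ᵥ w b = G b := by
      rw [hw, Matrix.mulVec_mulVec, Matrix.mul_nonsing_inv _ ((Matrix.isUnit_iff_isUnit_det _).1 hb),
        Matrix.one_mulVec]
    exact congrFun this k
  have hQ : HasFDerivAt (fun b => ∑ k, G b k * w b k)
      (∑ k, (G β k • fderiv ℝ (fun b => w b k) β + w β k • fderiv ℝ (fun b => G b k) β)) β :=
    HasFDerivAt.fun_sum fun k _ => (hG k).hasFDerivAt.mul (hwd k).hasFDerivAt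
  refine ⟨hQ.differentiableAt.congr_of_eventuallyEq heq, fun e => ?_⟩
  rw [heq.fderiv_eq, hQ.fderiv]
  have hk : ∀ k, fderiv ℝ (fun b => G b k) β e = ∑ l, (C β k l * fderiv ℝ (fun b => w b l) β e +
      w β l * fderiv ℝ (fun b => C b k l) β e) := fun k => by
    have h1 : HasFDerivAt (fun b => ∑ l, C b k l * w b l) (∑ l, (C β k l • fderiv ℝ (fun b => w b l)
        β + w β l • fderiv ℝ (fun b => C b k l) β)) β :=
      HasFDerivAt.fun_sum fun l _ => (hC k l).hasFDerivAt.mul (hwd l).hasFDerivAt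
    rw [← (hCw k).fderiv_eq, h1.fderiv]
    simp
  have hGk : ∀ k, G β k = ∑ l, C β k l * w β l := fun k => ((hCw k).self_of_nhds).symm
  have hsym : ∀ k l, C β k l = C β l k := fun k l => by
    simpa using (hs β).apply l k
  have h1 : ∑ k, G β k * fderiv ℝ (fun b => w b k) β e =
      ∑ k, w β k * (fderiv ℝ (fun b => G b k) β e - ∑ l, w β l * fderiv ℝ (fun b => C b k l) β e) := by
    simp only [hk, Finset.sum_add_distrib, add_sub_cancel_right]
    simp only [hGk, Finset.sum_mul, Finset.mul_sum]
    rw [Finset.sum_comm]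
    refine Finset.sum_congr rfl fun k _ => Finset.sum_congr rfl fun l _ => ?_
    rw [hsym k l]
    ring
  simp only [sum_apply, _root_.add_apply,
    smul_apply, smul_eq_mul, Finset.sum_add_distrib]
  rw [h1]
  simp only [mul_sub, Finset.sum_sub_distrib, Finset.mul_sum]
  have h2 : ∀ k, w β k * fderiv ℝ (fun b => G b k) β e = fderiv ℝ (fun b => G b k) β e * w β k :=
    fun k => mul_comm _ _
  have h3 : ∀ k l, w β k * (w β l * fderiv ℝ (fun b => C b k l) β e) =
    w β k * fderiv ℝ (fun b => C b k l) β e * w β l := fun k l => by ring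
  simp only [h2, h3, ← Finset.mul_sum]
  ring

theorem gradFactor_mulVec (G : R → ℝ) (G' : Matrix R (Fin q) ℝ) (C : Matrix R R ℝ)
    (C' : Fin q → Matrix R R ℝ) (l : Fin q) :
    (gradFactor G G' C C' *ᵥ G) l = 2 * ∑ k, G' k l * (C⁻¹ *ᵥ G) k -
      ∑ i, ∑ j, (C⁻¹ *ᵥ G) i * C' l i j * (C⁻¹ *ᵥ G) j := by
  rw [gradFactor, Matrix.sub_mulVec, Matrix.smul_mulVec, ← Matrix.mulVec_mulVec,
    ← Matrix.mulVec_mulVec, Pi.sub_apply, Pi.smul_apply, smul_eq_mul]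
  congr 1
  simp only [Matrix.mulVec, Matrix.of_apply, dotProduct, Matrix.vecMul, Finset.sum_mul]
  rw [Finset.sum_comm]

theorem partialDeriv_quadForm {G : EuclideanSpace ℝ (Fin q) → R → ℝ}
    {C : EuclideanSpace ℝ (Fin q) → Matrix R R ℝ} {β : EuclideanSpace ℝ (Fin q)}
    (hG : ∀ k, DifferentiableAt ℝ (fun b => G b k) β)
    (hC : ∀ k l, DifferentiableAt ℝ (fun b => C b k l) β)
    (hs : ∀ b, (C b).IsHermitian) (hu : IsUnit (C β)) (l : Fin q) :
    partialDeriv (fun b => G b ⬝ᵥ (pinv (C b) *ᵥ G b)) l β =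
      (gradFactor (G β) (jacobian G β) (C β) (matrixDeriv C β) *ᵥ G β) l := by
  rw [gradFactor_mulVec, partialDeriv, (hasFDerivAt_quadForm hG hC hs hu).2]
  rfl

end Calculus

/-! ### Deterministic consistency and linearization of minimizers -/

section Deterministic

theorem isLittleO_mulVec {α m n : Type*} [Fintype m] [Fintype n] {l : Filter α}
    {T : α → Matrix m n ℝ} (hT : Tendsto T l (𝓝 0)) (y : α → n → ℝ) :
    (fun a => T a *ᵥ y a) =o[l] y := by
  rw [Asymptotics.isLittleO_pi]
  intro i
  simp only [Matrix.mulVec, dotProduct]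
  refine Asymptotics.IsLittleO.fun_sum fun j _ => ?_
  have h1 : (fun a => T a i j) =o[l] fun _ => (1 : ℝ) :=
    (Asymptotics.isLittleO_one_iff ℝ).2 (tendsto_pi_nhds.1 (tendsto_pi_nhds.1 hT i) j)
  have h2 : (fun a => y a j) =O[l] fun a => ‖y a‖ :=
    Asymptotics.IsBigO.of_bound 1 (.of_forall fun a => by simpa using norm_le_pi_norm (y a) j)
  simpa using (h1.mul_isBigO h2).norm_right

variable {q : ℕ} {R : Type*} {B : Set (EuclideanSpace ℝ (Fin q))} {β₀ : EuclideanSpace ℝ (Fin q)}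
  {G : ℕ → EuclideanSpace ℝ (Fin q) → R → ℝ} {D : EuclideanSpace ℝ (Fin q) → Matrix R (Fin q) ℝ}

/-- Mean value expansion, with a Jacobian that converges to the limiting one. -/
theorem exists_jacobian_expansion (hβ₀ : β₀ ∈ interior B)
    (hD : ∀ k l, ContConvOn (fun N β => jacobian (G N) β k l) (fun β => D β k l) B)
    (hGd : ∀ N, ∀ β ∈ B, ∀ k, DifferentiableAt ℝ (fun b => G N b k) β)
    {b : ℕ → EuclideanSpace ℝ (Fin q)} (hlim : Tendsto b atTop (𝓝 β₀)) :
    ∃ DN : ℕ → Matrix R (Fin q) ℝ, Tendsto DN atTop (𝓝 (D β₀)) ∧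
      ∀ᶠ N in atTop, G N (b N) = G N β₀ + DN N *ᵥ (b N - β₀).ofLp := by
  obtain ⟨r, hr, hrB⟩ := Metric.mem_nhds_iff.1 (mem_interior_iff_mem_nhds.1 hβ₀)
  have hball : ∀ᶠ N in atTop, b N ∈ Metric.ball β₀ r := hlim (Metric.ball_mem_nhds _ hr)
  -- The mean value theorem holds only coordinatewise, so each row of the matrix `DN` has its own
  -- intermediate point; all of them tend to β₀.
  have hmv : ∀ N k, b N ∈ Metric.ball β₀ r → ∃ z ∈ segment ℝ β₀ (b N),
      G N (b N) k - G N β₀ k = fderiv ℝ (fun b => G N b k) z (b N - β₀) := fun N k hN =>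
    domain_mvt (s := Metric.ball β₀ r) (f := fun b => G N b k)
      (f' := fun z => fderiv ℝ (fun b => G N b k) z)
      (fun z hz => (hGd N z (hrB hz) k).hasFDerivAt.hasFDerivWithinAt) (convex_ball _ _)
      (Metric.mem_ball_self hr) hN
  choose! z hz hzG using hmv
  have hzlim : ∀ k, Tendsto (fun N => z N k) atTop (𝓝 β₀) := fun k => by
    rw [tendsto_iff_dist_tendsto_zero] at hlim ⊢
    refine squeeze_zero' (.of_forall fun _ => dist_nonneg) ?_ hlim
    filter_upwards [hball] with N hN
    have h1 := segment_subset_closedBall_left β₀ (b N) (hz N k hN)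
    rw [Metric.mem_closedBall, dist_comm β₀] at h1
    exact h1
  have hzB : ∀ k, ∀ᶠ N in atTop, z N k ∈ B := fun k =>
    (hzlim k).eventually (mem_interior_iff_mem_nhds.1 hβ₀)
  refine ⟨fun N => Matrix.of fun k l => jacobian (G N) (z N k) k l, ?_, ?_⟩
  · exact tendsto_pi_nhds.2 fun k => tendsto_pi_nhds.2 fun l =>
      hD k l _ le_rfl _ _ (interior_subset hβ₀) (hzB k) (hzlim k)
  · filter_upwards [hball] with N hN
    ext k
    have h1 := hzG N k hN
    have h2 : b N - β₀ = ∑ l, (b N - β₀) l • EuclideanSpace.single l (1 : ℝ) := by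
      ext i
      simp [Pi.single_apply]
    rw [h2, map_sum] at h1
    simp only [map_smul, smul_eq_mul] at h1
    simp only [Pi.add_apply, Matrix.mulVec, dotProduct, Matrix.of_apply, jacobian, partialDeriv]
    rw [← sub_eq_iff_eq_add', h1]
    exact Finset.sum_congr rfl fun l _ => mul_comm _ _

variable [Fintype R] [DecidableEq R] {m : EuclideanSpace ℝ (Fin q) → R → ℝ}
  {C : ℕ → EuclideanSpace ℝ (Fin q) → Matrix R R ℝ}
  {S : EuclideanSpace ℝ (Fin q) → Matrix R R ℝ}

/-- A minimizer over `B` of `Gᵀ C⁻¹ G` converges to the only zero of the limit of `G`. -/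
theorem tendsto_minimizer (hB : IsCompact B) (hβ₀ : β₀ ∈ B)
    (hG : ∀ k, ContConvOn (fun N β => G N β k) (fun β => m β k) B)
    (hC : ∀ k l, ContConvOn (fun N β => C N β k l) (fun β => S β k l) B)
    (hs : ∀ N β, (C N β).IsHermitian) (hS : ∀ β ∈ B, (S β).PosDef)
    (hm₀ : m β₀ = 0) (hm : ∀ β ∈ B, m β = 0 → β = β₀)
    {b : ℕ → EuclideanSpace ℝ (Fin q)} (hb : ∀ N, b N ∈ B)
    (hmin : ∀ᶠ N in atTop, IsMinOn (fun β => G N β ⬝ᵥ (pinv (C N β) *ᵥ G N β)) B (b N)) :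
    Tendsto b atTop (𝓝 β₀) := by
  have key : ∀ l : Filter ℕ, l ≤ atTop → ∀ b : ℕ → EuclideanSpace ℝ (Fin q), (∀ N, b N ∈ B) →
      ∀ β ∈ B, Tendsto b l (𝓝 β) →
      Tendsto (fun N => G N (b N) ⬝ᵥ (pinv (C N (b N)) *ᵥ G N (b N))) l
        (𝓝 (m β ⬝ᵥ ((S β)⁻¹ *ᵥ m β))) := by
    intro l hl b hb β hβ hlim
    have h1 : Tendsto (fun N => G N (b N)) l (𝓝 (m β)) :=
      tendsto_pi_nhds.2 fun k => hG k l hl b β hβ (.of_forall hb) hlim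
    have h2 : Tendsto (fun N => C N (b N)) l (𝓝 (S β)) := tendsto_pi_nhds.2 fun i =>
      tendsto_pi_nhds.2 fun j => hC i j l hl b β hβ (.of_forall hb) hlim
    have hu := (hS β hβ).isUnit
    have h3 : Tendsto (fun N => pinv (C N (b N))) l (𝓝 (S β)⁻¹) := by
      refine (tendsto_matrix_inv h2 hu).congr' ?_
      filter_upwards [isUnit_eventually_of_tendsto h2 hu] with N hN
      exact (pinv_eq_inv _ (hs _ _) hN).symm
    have h4 := tendsto_matrix_mulVec h3 h1
    simp only [dotProduct]
    exact tendsto_finsetSum _ fun k _ =>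
      (tendsto_pi_nhds.1 h1 k).mul (tendsto_pi_nhds.1 h4 k)
  -- In a compact set it suffices that β₀ is the only cluster point. A cluster point is a limit
  -- along an ultrafilter finer than `atTop`; this is why `key` allows every such filter.
  refine hB.tendsto_nhds_of_unique_mapClusterPt (.of_forall hb) fun β hβ hcl => ?_
  obtain ⟨U, hU, hUb⟩ := mapClusterPt_iff_ultrafilter.1 hcl
  have h1 := key U hU b hb β hβ hUb
  have h2 := key U hU (fun _ => β₀) (fun _ => hβ₀) β₀ hβ₀ tendsto_const_nhds
  rw [hm₀, zero_dotProduct] at h2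
  -- Comparison with the value at β₀ gives mᵀΣ⁻¹m ≤ 0 at the cluster point, and positive
  -- definiteness then forces m = 0 there.
  have h3 := le_of_tendsto_of_tendsto h1 h2 (by
    filter_upwards [hU hmin] with N hN
    exact hN hβ₀)
  refine hm β hβ ?_
  by_contra hne
  have := (hS β hβ).inv.dotProduct_mulVec_pos hne
  simp only [star_trivial] at this
  linarith

variable {C' : EuclideanSpace ℝ (Fin q) → Fin q → Matrix R R ℝ}

/-- The part of the gradient factor that contains the derivative of C carries a factor G, which
tends to m(β₀) = 0; it drops out of the limit. -/
theorem tendsto_gradFactor_of_contConvOn (hβ₀ : β₀ ∈ B)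
    (hG : ∀ k, ContConvOn (fun N β => G N β k) (fun β => m β k) B)
    (hC : ∀ k l, ContConvOn (fun N β => C N β k l) (fun β => S β k l) B)
    (hD : ∀ k l, ContConvOn (fun N β => jacobian (G N) β k l) (fun β => D β k l) B)
    (hC' : ∀ l i j, ContConvOn (fun N β => matrixDeriv (C N) β l i j) (fun β => C' β l i j) B)
    (hS : (S β₀).PosDef) (hm₀ : m β₀ = 0)
    {b : ℕ → EuclideanSpace ℝ (Fin q)} (hb : ∀ᶠ N in atTop, b N ∈ B)
    (hlim : Tendsto b atTop (𝓝 β₀)) :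
    Tendsto (fun N => gradFactor (G N (b N)) (jacobian (G N) (b N)) (C N (b N))
      (matrixDeriv (C N) (b N))) atTop (𝓝 ((2 : ℝ) • ((D β₀)ᵀ * (S β₀)⁻¹))) := by
  have h := tendsto_gradFactor (l := atTop) (G := fun N => G N (b N)) (G₀ := m β₀)
    (G' := fun N => jacobian (G N) (b N)) (G'₀ := D β₀) (C := fun N => C N (b N)) (C₀ := S β₀)
    (C' := fun N => matrixDeriv (C N) (b N)) (C'₀ := C' β₀)
    (tendsto_pi_nhds.2 fun k => hG k _ le_rfl b β₀ hβ₀ hb hlim)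
    (tendsto_pi_nhds.2 fun i => tendsto_pi_nhds.2 fun j => hD i j _ le_rfl b β₀ hβ₀ hb hlim)
    (tendsto_pi_nhds.2 fun i => tendsto_pi_nhds.2 fun j => hC i j _ le_rfl b β₀ hβ₀ hb hlim)
    (tendsto_pi_nhds.2 fun l => tendsto_pi_nhds.2 fun i => tendsto_pi_nhds.2 fun j =>
      hC' l i j _ le_rfl b β₀ hβ₀ hb hlim) hS.isUnit
  rwa [hm₀, gradFactor_zero] at h

/-- The linearization of a consistent minimizer. -/
theorem isLittleO_minimizer (hβ₀ : β₀ ∈ interior B)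
    (hG : ∀ k, ContConvOn (fun N β => G N β k) (fun β => m β k) B)
    (hC : ∀ k l, ContConvOn (fun N β => C N β k l) (fun β => S β k l) B)
    (hD : ∀ k l, ContConvOn (fun N β => jacobian (G N) β k l) (fun β => D β k l) B)
    (hC' : ∀ l i j, ContConvOn (fun N β => matrixDeriv (C N) β l i j) (fun β => C' β l i j) B)
    (hGd : ∀ N, ∀ β ∈ B, ∀ k, DifferentiableAt ℝ (fun b => G N b k) β)
    (hCd : ∀ N, ∀ β ∈ B, ∀ k l, DifferentiableAt ℝ (fun b => C N b k l) β)
    (hs : ∀ N β, (C N β).IsHermitian) (hS : (S β₀).PosDef) (hm₀ : m β₀ = 0)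
    (hJ : IsUnit ((D β₀)ᵀ * (S β₀)⁻¹ * D β₀))
    {b : ℕ → EuclideanSpace ℝ (Fin q)} (hlim : Tendsto b atTop (𝓝 β₀))
    (hmin : ∀ᶠ N in atTop, IsMinOn (fun β => G N β ⬝ᵥ (pinv (C N β) *ᵥ G N β)) B (b N)) :
    (fun N => (b N - β₀).ofLp + (((D β₀)ᵀ * (S β₀)⁻¹ * D β₀)⁻¹ * ((D β₀)ᵀ * (S β₀)⁻¹)) *ᵥ G N β₀)
      =o[atTop] fun N => G N β₀ := by
  have hB₀ := interior_subset hβ₀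
  have hbint : ∀ᶠ N in atTop, b N ∈ interior B := hlim (isOpen_interior.mem_nhds hβ₀)
  have hbB : ∀ᶠ N in atTop, b N ∈ B := hbint.mono fun N hN => interior_subset hN
  obtain ⟨DN, hDN, hexp⟩ := exists_jacobian_expansion hβ₀ hD hGd hlim
  have hL := tendsto_gradFactor_of_contConvOn hB₀ hG hC hD hC' hS hm₀ hbB hlim
  set L : ℕ → Matrix (Fin q) R ℝ := fun N => gradFactor (G N (b N)) (jacobian (G N) (b N))
    (C N (b N)) (matrixDeriv (C N) (b N)) with hLdef
  have hCb : Tendsto (fun N => C N (b N)) atTop (𝓝 (S β₀)) := tendsto_pi_nhds.2 fun i =>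
    tendsto_pi_nhds.2 fun j => hC i j _ le_rfl b β₀ hB₀ hbB hlim
  have hfoc : ∀ᶠ N in atTop, L N *ᵥ G N (b N) = 0 := by
    filter_upwards [hmin, hbint, isUnit_eventually_of_tendsto hCb hS.isUnit] with N h1 h2 h3
    have h4 : IsLocalMin (fun β => G N β ⬝ᵥ (pinv (C N β) *ᵥ G N β)) (b N) :=
      h1.isLocalMin (mem_interior_iff_mem_nhds.1 h2)
    ext l
    rw [hLdef, ← partialDeriv_quadForm (hGd N _ (interior_subset h2))
      (hCd N _ (interior_subset h2)) (hs N) h3 l, partialDeriv, h4.fderiv_eq_zero]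
    rfl
  set J := (D β₀)ᵀ * (S β₀)⁻¹ * D β₀ with hJdef
  have hH : Tendsto (fun N => L N * DN N) atTop (𝓝 ((2 : ℝ) • J)) := by
    have := tendsto_matrix_mul hL hDN
    rwa [Matrix.smul_mul] at this
  have hJd : IsUnit J.det := (Matrix.isUnit_iff_isUnit_det _).1 hJ
  have h2J : IsUnit ((2 : ℝ) • J) := by
    rw [Matrix.isUnit_iff_isUnit_det, Matrix.det_smul]
    exact ((isUnit_iff_ne_zero.2 two_ne_zero).pow _).mul hJd
  have hinv2 : ((2 : ℝ) • J)⁻¹ = (2 : ℝ)⁻¹ • J⁻¹ := by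
    refine Matrix.inv_eq_right_inv ?_
    rw [Matrix.smul_mul, Matrix.mul_smul, smul_smul, Matrix.mul_nonsing_inv _ hJd]
    norm_num
  -- The limit of (L D_N)⁻¹ L is (2J)⁻¹ · 2DᵀΣ⁻¹ = K, so the error matrix tends to 0.
  have hT : Tendsto (fun N => J⁻¹ * ((D β₀)ᵀ * (S β₀)⁻¹) - (L N * DN N)⁻¹ * L N) atTop (𝓝 0) := by
    have h1 := (tendsto_const_nhds (x := J⁻¹ * ((D β₀)ᵀ * (S β₀)⁻¹))).sub
      (tendsto_matrix_mul (tendsto_matrix_inv hH h2J) hL)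
    rw [hinv2, Matrix.smul_mul, Matrix.mul_smul, smul_smul] at h1
    simpa using h1
  refine (isLittleO_mulVec hT fun N => G N β₀).congr' ?_ .rfl
  filter_upwards [hfoc, hexp, isUnit_eventually_of_tendsto hH h2J] with N h1 h2 h3
  rw [h2, Matrix.mulVec_add, Matrix.mulVec_mulVec] at h1
  have h4 : (b N - β₀).ofLp = - (((L N * DN N)⁻¹ * L N) *ᵥ G N β₀) := by
    have h5 : (L N * DN N) *ᵥ (b N - β₀).ofLp = - (L N *ᵥ G N β₀) := by
      rw [eq_neg_iff_add_eq_zero, add_comm]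
      exact h1
    rw [← Matrix.mulVec_mulVec, ← Matrix.mulVec_neg, ← h5, Matrix.mulVec_mulVec,
      Matrix.nonsing_inv_mul _ ((Matrix.isUnit_iff_isUnit_det _).1 h3), Matrix.one_mulVec]
  rw [h4, Matrix.sub_mulVec]
  abel

/-- The linearization of the gradient at the true parameter. -/
theorem isLittleO_gradFactor (hβ₀ : β₀ ∈ B)
    (hG : ∀ k, ContConvOn (fun N β => G N β k) (fun β => m β k) B)
    (hC : ∀ k l, ContConvOn (fun N β => C N β k l) (fun β => S β k l) B)
    (hD : ∀ k l, ContConvOn (fun N β => jacobian (G N) β k l) (fun β => D β k l) B)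
    (hC' : ∀ l i j, ContConvOn (fun N β => matrixDeriv (C N) β l i j) (fun β => C' β l i j) B)
    (hS : (S β₀).PosDef) (hm₀ : m β₀ = 0) (I : Matrix (Fin q) (Fin q) ℝ) :
    (fun N => ((2 : ℝ)⁻¹ • (I * gradFactor (G N β₀) (jacobian (G N) β₀) (C N β₀)
        (matrixDeriv (C N) β₀))) *ᵥ G N β₀ - (I * ((D β₀)ᵀ * (S β₀)⁻¹)) *ᵥ G N β₀)
      =o[atTop] fun N => G N β₀ := by
  have hL := tendsto_gradFactor_of_contConvOn hβ₀ hG hC hD hC' hS hm₀ (.of_forall fun _ => hβ₀)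
    tendsto_const_nhds
  have hT := ((tendsto_matrix_mul (tendsto_const_nhds (x := I)) hL).const_smul (2 : ℝ)⁻¹).sub
    (tendsto_const_nhds (x := I * ((D β₀)ᵀ * (S β₀)⁻¹)))
  rw [Matrix.mul_smul, smul_smul, inv_mul_cancel₀ two_ne_zero, one_smul, sub_self] at hT
  simpa only [Matrix.sub_mulVec] using isLittleO_mulVec hT fun N => G N β₀

end Deterministic

/-! ### Unbiasedness of the score at the true parameter -/

section Unbiased

variable {Ω 𝒳 : Type*} [MeasurableSpace Ω] [MeasurableSpace 𝒳] {μ : Measure Ω}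
  [IsProbabilityMeasure μ]

/-- A residual is orthogonal to bounded functions of the covariates. -/
theorem integral_mul_residual_eq_zero {X : Ω → 𝒳} (hX : Measurable X) {Y η : Ω → ℝ}
    (hY : Integrable Y μ) (hη : μ[Y | MeasurableSpace.comap X inferInstance] =ᵐ[μ] η)
    {c : 𝒳 → ℝ} (hc : Measurable c) {K : ℝ} (hK : ∀ x, |c x| ≤ K) :
    Integrable (fun ω => c (X ω) * (Y ω - η ω)) μ ∧ ∫ ω, c (X ω) * (Y ω - η ω) ∂μ = 0 := by
  have hηi : Integrable η μ := integrable_condExp.congr hη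
  have hm := hX.comap_le
  have hcX : AEStronglyMeasurable (fun ω => c (X ω)) μ := (hc.comp hX).aestronglyMeasurable
  have hb : ∀ᵐ ω ∂μ, ‖c (X ω)‖ ≤ K := .of_forall fun ω => hK _
  have h1 : Integrable (fun ω => c (X ω) * Y ω) μ := hY.bdd_mul hcX hb
  have h2 : Integrable (fun ω => c (X ω) * η ω) μ := hηi.bdd_mul hcX hb
  have hcm : StronglyMeasurable[MeasurableSpace.comap X inferInstance] fun ω => c (X ω) :=
    (hc.comp (comap_measurable X)).stronglyMeasurable
  have h3 : ∫ ω, c (X ω) * Y ω ∂μ = ∫ ω, c (X ω) * η ω ∂μ := by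
    rw [← integral_condExp hm]
    refine integral_congr_ae ?_
    filter_upwards [condExp_mul_of_stronglyMeasurable_left hcm h1 hY, hη] with ω h4 h5
    simp only [Pi.mul_apply] at h4
    rw [← h5, ← h4]
    rfl
  simp only [mul_sub]
  exact ⟨h1.sub h2, by rw [integral_sub h1 h2, h3, sub_self]⟩

/-- A weighted sum of residuals has mean zero as soon as it is integrable; the single weighted
residuals need not be. -/
theorem integral_sum_mul_residual_eq_zero {ι : Type*} [Fintype ι] {X : Ω → 𝒳} (hX : Measurable X)
    {Y η : ι → Ω → ℝ} (hY : ∀ t, Integrable (Y t) μ)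
    (hη : ∀ t, μ[Y t | MeasurableSpace.comap X inferInstance] =ᵐ[μ] η t)
    {w : ι → 𝒳 → ℝ} (hw : ∀ t, Measurable (w t))
    (hint : Integrable (fun ω => ∑ t, w t (X ω) * (Y t ω - η t ω)) μ) :
    ∫ ω, ∑ t, w t (X ω) * (Y t ω - η t ω) ∂μ = 0 := by
  -- Truncation: on `A m` all weights are bounded, so each weighted residual is integrable with mean
  -- zero. These sets depend on the covariates only and exhaust the space.
  let A : ℕ → Set 𝒳 := fun m => {x | ∀ t, |w t x| ≤ m}
  have hA : ∀ m, MeasurableSet (A m) := fun m => by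
    have : A m = ⋂ t, {x | |w t x| ≤ m} := by ext; simp [A]
    rw [this]
    exact MeasurableSet.iInter fun t => measurableSet_le (hw t).abs measurable_const
  have hzero : ∀ m, ∫ ω in X ⁻¹' A m, ∑ t, w t (X ω) * (Y t ω - η t ω) ∂μ = 0 := fun m => by
    have hc : ∀ t, Measurable ((A m).indicator (w t)) := fun t => (hw t).indicator (hA m)
    have hK : ∀ t x, |(A m).indicator (w t) x| ≤ m := fun t x => by
      by_cases hx : x ∈ A m
      · simpa [hx] using hx t
      · simp [hx]
    have h1 := fun t => integral_mul_residual_eq_zero hX (hY t) (hη t) (hc t) (hK t)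
    rw [← integral_indicator (hX (hA m))]
    have h2 : (X ⁻¹' A m).indicator (fun ω => ∑ t, w t (X ω) * (Y t ω - η t ω)) =
        fun ω => ∑ t, (A m).indicator (w t) (X ω) * (Y t ω - η t ω) := by
      ext ω
      by_cases hx : X ω ∈ A m
      · simp [Set.indicator, hx]
      · simp [Set.indicator, hx]
    rw [h2, integral_finsetSum _ fun t _ => (h1 t).1]
    exact Finset.sum_eq_zero fun t _ => (h1 t).2
  have hmono : Monotone fun m => X ⁻¹' A m := fun a b hab ω hω t =>
    (hω t).trans (Nat.cast_le.2 hab)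
  have hU : ⋃ m, X ⁻¹' A m = Set.univ := by
    refine Set.eq_univ_of_forall fun ω => Set.mem_iUnion.2 ?_
    obtain ⟨m, hm⟩ := exists_nat_ge (∑ t, |w t (X ω)|)
    exact ⟨m, fun t => (Finset.single_le_sum (f := fun t => |w t (X ω)|)
      (fun _ _ => abs_nonneg _) (Finset.mem_univ t)).trans hm⟩
  -- The truncation is removed for the whole sum at once, since only the sum is known to be
  -- integrable.
  have hlim := tendsto_setIntegral_of_monotone (fun m => hX (hA m)) hmono
    (hint.integrableOn (s := ⋃ m, X ⁻¹' A m))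
  rw [hU, setIntegral_univ] at hlim
  simp only [hzero] at hlim
  exact tendsto_nhds_unique hlim tendsto_const_nhds

variable {n q s : ℕ}

/-- The score is unbiased at a parameter for which the mean model holds. -/
theorem integral_score_eq_zero {h v : ℝ → ℝ} (hv : Measurable v) (φ : ℝ)
    (M : Fin s → Matrix (Fin n) (Fin n) ℝ) {Y : Ω → Fin n → ℝ}
    {X : Ω → Fin n → EuclideanSpace ℝ (Fin q)} (hX : Measurable X)
    {β₀ : EuclideanSpace ℝ (Fin q)} (hYint : ∀ t, Integrable (fun ω => Y ω t) μ)
    (hmean : ∀ t, μ[fun ω => Y ω t | MeasurableSpace.comap X inferInstance]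
      =ᵐ[μ] fun ω => h (inner ℝ (X ω t) β₀)) (k : Fin s × Fin q)
    (hint : Integrable (fun ω => score h v φ M (Y ω) (X ω) β₀ k) μ) :
    ∫ ω, score h v φ M (Y ω) (X ω) β₀ k ∂μ = 0 := by
  refine integral_sum_mul_residual_eq_zero hX hYint hmean
    (w := fun t x => ((meanJacobian h x β₀)ᵀ * invSqrtVar v φ x β₀ * M k.1 *
      invSqrtVar v φ x β₀) k.2 t) 
    (fun t => measurable_scoreWeight hv φ (M k.1) β₀ k.2 t) hint

end Unbiased

/-! ### Uniform laws for smooth random functions and their derivatives -/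

section LawsOfLargeNumbers

theorem ContConvOn.congr {E : Type*} [MetricSpace E] {A A' : ℕ → E → ℝ} {a : E → ℝ} {B : Set E}
    (h : ContConvOn A a B) (hA : ∀ N, ∀ β ∈ B, A' N β = A N β) : ContConvOn A' a B := by
  intro l hl b β hβ hb hlim
  refine (h l hl b β hβ hb hlim).congr' ?_
  filter_upwards [hb] with N hN
  exact (hA N _ hN).symm

variable {Ω 𝒳 : Type*} [MeasurableSpace Ω] [MeasurableSpace 𝒳] {μ : Measure Ω}
  [IsProbabilityMeasure μ] {q : ℕ} {B : Set (EuclideanSpace ℝ (Fin q))}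
  {d : ℕ → Ω → 𝒳} {f : 𝒳 → EuclideanSpace ℝ (Fin q) → ℝ}

theorem abs_partialDeriv_le (f : EuclideanSpace ℝ (Fin q) → ℝ) (l : Fin q)
    (β : EuclideanSpace ℝ (Fin q)) : |partialDeriv f l β| ≤ ‖iteratedFDeriv ℝ 1 f β‖ := by
  rw [norm_iteratedFDeriv_one]
  simpa [partialDeriv] using (fderiv ℝ f β).le_opNorm (EuclideanSpace.single l 1)

/-- Uniform laws of large numbers for i.i.d. smooth random functions and their partial
derivatives. -/
theorem contConvOn_mean_of_contDiffAt (hB : IsCompact B) (hd : ∀ i, Measurable (d i))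
    (hindep : iIndepFun d μ) (hident : ∀ i, IdentDistrib (d i) (d 0) μ μ)
    (hf : ∀ β, Measurable fun x => f x β)
    (hsmooth : ∀ i, ∀ᵐ ω ∂μ, ∀ β ∈ B, ContDiffAt ℝ 2 (f (d i ω)) β)
    {b : Ω → ℝ} (hb : Integrable b μ)
    (hdom : ∀ᵐ ω ∂μ, ∀ β ∈ B, ∀ m ≤ 2, ‖iteratedFDeriv ℝ m (f (d 0 ω)) β‖ ≤ b ω) :
    (∀ᵐ ω ∂μ, ContConvOn (fun N β => (N : ℝ)⁻¹ * ∑ i ∈ Finset.range N, f (d i ω) β)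
      (fun β => ∫ ω, f (d 0 ω) β ∂μ) B) ∧
    (∀ᵐ ω ∂μ, ∀ N : ℕ, ∀ β ∈ B,
      DifferentiableAt ℝ (fun β => (N : ℝ)⁻¹ * ∑ i ∈ Finset.range N, f (d i ω) β) β) ∧
    (∀ (N : ℕ) l, ∀ β ∈ B, AEMeasurable (fun ω =>
      partialDeriv (fun β => (N : ℝ)⁻¹ * ∑ i ∈ Finset.range N, f (d i ω) β) l β) μ) ∧
    ∀ l, ∀ᵐ ω ∂μ, ContConvOn
      (fun N => partialDeriv (fun β => (N : ℝ)⁻¹ * ∑ i ∈ Finset.range N, f (d i ω) β) l)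
      (fun β => ∫ ω, partialDeriv (f (d 0 ω)) l β ∂μ) B := by
  have hdiff : ∀ᵐ ω ∂μ, ∀ i, ∀ β ∈ B, DifferentiableAt ℝ (f (d i ω)) β := by
    filter_upwards [ae_all_iff.2 hsmooth] with ω hω i β hβ
    exact (hω i β hβ).differentiableAt (by norm_num)
  have hpd : ∀ᵐ ω ∂μ, ∀ (N : ℕ) l, ∀ β ∈ B,
      partialDeriv (fun β => (N : ℝ)⁻¹ * ∑ i ∈ Finset.range N, f (d i ω) β) l β =
        (N : ℝ)⁻¹ * ∑ i ∈ Finset.range N, partialDeriv (f (d i ω)) l β := by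
    filter_upwards [hdiff] with ω hω N l β hβ
    have h1 : HasFDerivAt (fun β => (N : ℝ)⁻¹ * ∑ i ∈ Finset.range N, f (d i ω) β)
        ((N : ℝ)⁻¹ • ∑ i ∈ Finset.range N, fderiv ℝ (f (d i ω)) β) β :=
      (HasFDerivAt.fun_sum fun i _ => (hω i β hβ).hasFDerivAt).const_mul _
    rw [partialDeriv, h1.fderiv]
    simp [partialDeriv]
  refine ⟨?_, ?_, fun N l β hβ => ?_, fun l => ?_⟩
  · refine contConvOn_mean hB hd hindep hident f (fun β _ => hf β)
      (fun i => .of_forall fun _ _ _ => rfl) (fun i => ?_) hb ?_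
    · filter_upwards [hsmooth i] with ω hω β hβ
      exact (hω β hβ).continuousAt.continuousWithinAt
    · filter_upwards [hdom] with ω hω β hβ
      simpa using hω β hβ 0 (by norm_num)
  · filter_upwards [hdiff] with ω hω N β hβ
    exact (DifferentiableAt.fun_sum fun i _ => hω i β hβ).const_mul _
  · obtain ⟨f', hf', hff'⟩ := exists_measurable_partialDeriv hf l
    refine ⟨fun ω => (N : ℝ)⁻¹ * ∑ i ∈ Finset.range N, f' (d i ω) β,
      (Finset.measurable_fun_sum _ fun i _ => (hf' β).comp (hd i)).const_mul _, ?_⟩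
    filter_upwards [hpd, hdiff] with ω h1 h2
    rw [h1 N l β hβ]
    exact congrArg _ (Finset.sum_congr rfl fun i _ => hff' _ _ (h2 i β hβ))
  -- The limit of difference quotients `f'` serves as a version of the partial derivative that is
  -- measurable in the data.
  · obtain ⟨f', hf', hff'⟩ := exists_measurable_partialDeriv hf l
    have h := contConvOn_mean hB hd hindep hident (g := fun i ω β => partialDeriv (f (d i ω)) l β)
      f' (fun β _ => hf' β) (fun i => ?_) (fun i => ?_) hb ?_
    · filter_upwards [h, hpd] with ω h1 h2
      exact h1.congr fun N β hβ => h2 N l β hβ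
    · filter_upwards [hdiff] with ω hω β hβ
      exact hff' _ _ (hω i β hβ)
    · filter_upwards [hsmooth i] with ω hω β hβ
      have h1 := ((hω β hβ).fderiv_right (m := 1) (by norm_num)).continuousAt
      exact (h1.clm_apply continuousAt_const).continuousWithinAt
    · filter_upwards [hdom] with ω hω β hβ
      exact (abs_partialDeriv_le _ l β).trans (hω β hβ 1 (by norm_num))

end LawsOfLargeNumbers

/-! ### Exceptional events, change of norm and measurability -/

section Auxiliary

variable {Ω : Type*} [MeasurableSpace Ω] {μ : Measure Ω}

/-- Needed because the closed form of Z_N is available only off the event that the sample moment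
matrix is singular, whose probability tends to 0. No measurability of `W` is required. -/
theorem tendstoInMeasure_congr_off {F : Type*} [NormedAddCommGroup F] {V W : ℕ → Ω → F}
    (hV : TendstoInMeasure μ V atTop fun _ => 0) {P : ℕ → Set Ω}
    (hP : Tendsto (fun N => μ (P N)) atTop (𝓝 0))
    (h : ∀ᶠ N in atTop, ∀ᵐ ω ∂μ, ω ∉ P N → W N ω = V N ω) :
    TendstoInMeasure μ W atTop fun _ => 0 := by
  rw [tendstoInMeasure_iff_norm] at hV ⊢
  intro ε hε
  have h1 := (hV ε hε).add hP
  rw [add_zero] at h1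
  refine tendsto_of_tendsto_of_tendsto_of_le_of_le' tendsto_const_nhds h1
    (.of_forall fun _ => zero_le) ?_
  filter_upwards [h] with N hN
  refine (measure_mono_ae ?_).trans (measure_union_le _ _)
  filter_upwards [hN] with ω hω h2
  by_cases hP : ω ∈ P N
  · exact Or.inr hP
  · left
    change ε ≤ ‖W N ω - 0‖ at h2
    change ε ≤ ‖V N ω - 0‖
    rwa [← hω hP]

/-- Passes from the supremum norm of plain functions to the Euclidean norm; the two are equivalent
in finite dimension. -/
theorem isLittleO_toLp {α ι κ : Type*} [Fintype ι] [Fintype κ] {l : Filter α} {u : α → ι → ℝ}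
    {w : α → κ → ℝ} (h : u =o[l] w) :
    (fun a => WithLp.toLp 2 (u a)) =o[l] fun a => WithLp.toLp 2 (w a) := by
  have h1 : (fun a => WithLp.toLp 2 (u a)) =O[l] u :=
    (EuclideanSpace.equiv ι ℝ).symm.toContinuousLinearMap.isBigO_comp u l
  have h2 : w =O[l] fun a => WithLp.toLp 2 (w a) :=
    (EuclideanSpace.equiv κ ℝ).toContinuousLinearMap.isBigO_comp (fun a => WithLp.toLp 2 (w a)) l
  exact (h1.trans_isLittleO h).trans_isBigO h2

theorem aemeasurable_inv_apply {R : Type*} [Fintype R] [DecidableEq R] {C : Ω → Matrix R R ℝ}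
    (hC : ∀ i j, AEMeasurable (fun ω => C ω i j) μ) (i j : R) :
    AEMeasurable (fun ω => (C ω)⁻¹ i j) μ := by
  have hdet : ∀ A : Ω → Matrix R R ℝ, (∀ i j, AEMeasurable (fun ω => A ω i j) μ) →
      AEMeasurable (fun ω => (A ω).det) μ := fun A hA => by
    simp only [Matrix.det_apply']
    exact Finset.aemeasurable_fun_sum _ fun σ _ =>
      (Finset.aemeasurable_fun_prod _ fun i _ => hA _ _).const_mul _
  simp only [Matrix.inv_def, Matrix.smul_apply, Matrix.adjugate_apply, Ring.inverse_eq_inv',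
    smul_eq_mul]
  refine (hdet C hC).inv.mul (hdet _ fun a b => ?_)
  by_cases ha : a = j
  · subst ha
    simp
  · simpa [Matrix.updateRow_ne ha] using hC a b

theorem aemeasurable_gradFactor_apply {q : ℕ} {R : Type*} [Fintype R] [DecidableEq R]
    {G : Ω → R → ℝ} {G' : Ω → Matrix R (Fin q) ℝ} {C : Ω → Matrix R R ℝ}
    {C' : Ω → Fin q → Matrix R R ℝ} (hG : ∀ k, AEMeasurable (fun ω => G ω k) μ)
    (hG' : ∀ k l, AEMeasurable (fun ω => G' ω k l) μ) (hC : ∀ i j, AEMeasurable (fun ω => C ω i j) μ)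
    (hC' : ∀ l i j, AEMeasurable (fun ω => C' ω l i j) μ) (l : Fin q) (k : R) :
    AEMeasurable (fun ω => gradFactor (G ω) (G' ω) (C ω) (C' ω) l k) μ := by
  have hI := aemeasurable_inv_apply hC
  simp only [gradFactor, Matrix.sub_apply, Matrix.smul_apply, smul_eq_mul, Matrix.mul_apply,
    Matrix.transpose_apply, Matrix.of_apply, Matrix.vecMul, Matrix.mulVec, dotProduct]
  refine ((Finset.aemeasurable_fun_sum _ fun i _ => (hG' i l).mul (hI i k)).const_mul _).sub
    (Finset.aemeasurable_fun_sum _ fun i _ => ?_)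
  exact (Finset.aemeasurable_fun_sum _ fun j _ => (Finset.aemeasurable_fun_sum _ fun c _ =>
    (hI j c).mul (hG c)).mul (hC' l j i)).mul (hI i k)

end Auxiliary

/-! ### The abstract regular score model: linearization and limit law -/

section Asymptotics

variable {R : Type*} {q : ℕ}

theorem isHermitian_sampleMoment {Ω : Type*} (g : ℕ → Ω → EuclideanSpace ℝ (Fin q) → R → ℝ)
    (N : ℕ) (ω : Ω) (β : EuclideanSpace ℝ (Fin q)) : (sampleMoment g N ω β).IsHermitian := by
  ext k l
  simp [sampleMoment, mul_comm]


/-- The normalized score `√N ḡ_N(β₀)`. -/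
noncomputable def normalizedScore {Ω : Type*} (g : ℕ → Ω → EuclideanSpace ℝ (Fin q) → R → ℝ)
    (β₀ : EuclideanSpace ℝ (Fin q)) (N : ℕ) (ω : Ω) : EuclideanSpace ℝ R :=
  WithLp.toLp 2 (√(N : ℝ) • meanScore g N ω β₀)

theorem normalizedScore_eq {Ω : Type*} (g : ℕ → Ω → EuclideanSpace ℝ (Fin q) → R → ℝ)
    (β₀ : EuclideanSpace ℝ (Fin q)) (N : ℕ) (ω : Ω) :
    normalizedScore g β₀ N ω =
      (√(N : ℝ))⁻¹ • ∑ i ∈ Finset.range N, WithLp.toLp 2 (g i ω β₀) := by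
  ext k
  simp only [normalizedScore, meanScore, WithLp.ofLp_smul, WithLp.ofLp_sum, Pi.smul_apply,
    Finset.sum_apply, smul_eq_mul]
  -- √N / N = 1 / √N also holds for N = 0, where both sides are 0.
  rw [← mul_assoc, ← div_eq_mul_inv, Real.sqrt_div_self', one_div]

variable [Fintype R]

variable {Ω : Type*} [MeasurableSpace Ω] {μ : Measure Ω}

/-- Asymptotic normality of a fixed linear image of the score sum. -/
theorem tendstoInDistribution_mulVec [IsProbabilityMeasure μ] {ι : Type*} [Fintype ι] [DecidableEq ι]
    {X : ℕ → Ω → EuclideanSpace ℝ R} (hX : ∀ i, Measurable (X i)) (hindep : iIndepFun X μ)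
    (hident : ∀ i, IdentDistrib (X i) (X 0) μ μ) (h2 : ∀ k, MemLp (fun ω => X 0 ω k) 2 μ)
    (h0 : ∀ k, ∫ ω, X 0 ω k ∂μ = 0) {S : Matrix R R ℝ} (hS : S.PosSemidef)
    (hcov : ∀ k l, ∫ ω, X 0 ω k * X 0 ω l ∂μ = S k l) (K : Matrix ι R ℝ) :
    TendstoInDistribution (fun (N : ℕ) ω =>
        WithLp.toLp 2 (K *ᵥ ((√(N : ℝ))⁻¹ • ∑ i ∈ Finset.range N, X i ω).ofLp)) atTop
      (id : EuclideanSpace ℝ ι → EuclideanSpace ℝ ι) (fun _ => μ)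
      (multivariateGaussian 0 (K * S * Kᵀ)) := by
  have hK : Measurable fun x : EuclideanSpace ℝ R => WithLp.toLp 2 (K *ᵥ x.ofLp) := by
    refine Continuous.measurable ?_
    fun_prop
  have hint : ∀ k, Integrable (fun ω => X 0 ω k) μ := fun k => (h2 k).integrable (by norm_num)
  have hint2 : ∀ k l, Integrable (fun ω => X 0 ω k * X 0 ω l) μ := fun k l =>
    (h2 k).integrable_mul (h2 l)
  have hsum : (fun (N : ℕ) ω =>
      WithLp.toLp 2 (K *ᵥ ((√(N : ℝ))⁻¹ • ∑ i ∈ Finset.range N, X i ω).ofLp)) =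
      fun (N : ℕ) ω => (√(N : ℝ))⁻¹ • ∑ i ∈ Finset.range N, WithLp.toLp 2 (K *ᵥ (X i ω).ofLp) := by
    ext N ω a
    simp [Matrix.mulVec_smul, Matrix.mulVec_sum]
  rw [hsum]
  refine tendstoInDistribution_multivariate (X := fun i ω => WithLp.toLp 2 (K *ᵥ (X i ω).ofLp))
    (fun i => hK.comp (hX i)) (hindep.comp (fun _ x => WithLp.toLp 2 (K *ᵥ x.ofLp)) fun _ => hK)
    (fun i => (hident i).comp hK) (fun a => ?_) (fun a => ?_) ?_ (fun a c => ?_)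
  · simp only [Matrix.mulVec, dotProduct]
    exact memLp_finsetSum _ fun k _ => (h2 k).const_mul _
  · simp only [Matrix.mulVec, dotProduct]
    rw [integral_finsetSum _ fun k _ => (hint k).const_mul _]
    simp [integral_const_mul, h0]
  · simpa using hS.mul_mul_conjTranspose_same K
  · simp only [Matrix.mulVec, dotProduct, Finset.sum_mul_sum]
    have h1 : ∀ k l, (fun ω => K a k * X 0 ω k * (K c l * X 0 ω l)) =
        fun ω => K a k * K c l * (X 0 ω k * X 0 ω l) := fun k l => by
      ext ω
      ring
    have hprod : ∀ k l, Integrable (fun ω => K a k * X 0 ω k * (K c l * X 0 ω l)) μ := fun k l => by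
      rw [h1]
      exact (hint2 k l).const_mul _
    rw [integral_finsetSum _ fun k _ => integrable_finsetSum _ fun l _ => hprod k l]
    simp only [Matrix.mul_apply, Finset.sum_mul, Matrix.transpose_apply]
    rw [Finset.sum_comm]
    refine Finset.sum_congr rfl fun k _ => ?_
    rw [integral_finsetSum _ fun l _ => hprod k l]
    refine Finset.sum_congr rfl fun l _ => ?_
    rw [h1, integral_const_mul, hcov]
    ring

variable [DecidableEq R]

/-- The matrix `K = J⁻¹ Dᵀ Σ⁻¹` satisfies `K Σ Kᵀ = J⁻¹`. -/
theorem sandwich_eq {D : Matrix R (Fin q) ℝ} {S : Matrix R R ℝ} (hS : S.PosDef)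
    (hJ : IsUnit (Dᵀ * S⁻¹ * D)) :
    ((Dᵀ * S⁻¹ * D)⁻¹ * (Dᵀ * S⁻¹)) * S * ((Dᵀ * S⁻¹ * D)⁻¹ * (Dᵀ * S⁻¹))ᵀ =
      (Dᵀ * S⁻¹ * D)⁻¹ := by
  have hSt : Sᵀ = S := by simpa using hS.isHermitian.eq
  have hSd := (Matrix.isUnit_iff_isUnit_det _).1 hS.isUnit
  have hJt : (Dᵀ * S⁻¹ * D)ᵀ = Dᵀ * S⁻¹ * D := by
    simp [Matrix.transpose_mul, Matrix.transpose_nonsing_inv, hSt, Matrix.mul_assoc]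
  rw [Matrix.transpose_mul, Matrix.transpose_mul, Matrix.transpose_nonsing_inv,
    Matrix.transpose_nonsing_inv, hJt, hSt, Matrix.transpose_transpose]
  have hJd := (Matrix.isUnit_iff_isUnit_det _).1 hJ
  set J := Dᵀ * S⁻¹ * D with hJdef
  calc J⁻¹ * (Dᵀ * S⁻¹) * S * (S⁻¹ * D * J⁻¹)
      = J⁻¹ * (Dᵀ * (S⁻¹ * S) * S⁻¹ * D) * J⁻¹ := by simp only [Matrix.mul_assoc]
    _ = J⁻¹ * J * J⁻¹ := by rw [Matrix.nonsing_inv_mul _ hSd, Matrix.mul_one]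
    _ = J⁻¹ := by rw [Matrix.nonsing_inv_mul _ hJd, Matrix.one_mul]

/-- The matrix `K = J⁻¹ Dᵀ Σ⁻¹` at `β₀`, which maps the mean score to minus the linear part of the
estimation error. -/
noncomputable def influence (μ : Measure Ω) (g₁ : Ω → EuclideanSpace ℝ (Fin q) → R → ℝ)
    (β₀ : EuclideanSpace ℝ (Fin q)) : Matrix (Fin q) R ℝ :=
  (infoMatrix μ g₁ β₀)⁻¹ * ((meanDeriv μ g₁ β₀)ᵀ * (sigma μ g₁ β₀)⁻¹)

/-- The matrix `L` for which `∇Q_N(β₀) = N L ḡ_N(β₀)`, if the sample moment matrix is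
nonsingular. -/
noncomputable def scoreGradFactor (g : ℕ → Ω → EuclideanSpace ℝ (Fin q) → R → ℝ)
    (β₀ : EuclideanSpace ℝ (Fin q)) (N : ℕ) (ω : Ω) : Matrix (Fin q) R ℝ :=
  gradFactor (meanScore g N ω β₀) (jacobian (meanScore g N ω) β₀) (sampleMoment g N ω β₀)
    (matrixDeriv (sampleMoment g N ω) β₀)

/-- The assumptions on an i.i.d. sequence of random score functions `f (d i)` under which the
minimizer of the quadratic inference function is asymptotically normal. -/
structure RegularScore {𝒳 : Type*} [MeasurableSpace 𝒳] (μ : Measure Ω) (d : ℕ → Ω → 𝒳)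
    (f : 𝒳 → EuclideanSpace ℝ (Fin q) → R → ℝ) (B : Set (EuclideanSpace ℝ (Fin q)))
    (β₀ : EuclideanSpace ℝ (Fin q)) (b : Ω → ℝ) : Prop where
  measurable_data : ∀ i, Measurable (d i)
  indep : iIndepFun d μ
  identDistrib : ∀ i, IdentDistrib (d i) (d 0) μ μ
  isCompact : IsCompact B
  mem_interior : β₀ ∈ interior B
  measurable_score : ∀ β k, Measurable fun x => f x β k
  mean_eq_zero : ∀ k, ∫ ω, f (d 0 ω) β₀ k ∂μ = 0
  identifiable : ∀ β ∈ B, (∀ k, ∫ ω, f (d 0 ω) β k ∂μ = 0) → β = β₀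
  posDef : ∀ β ∈ B, (sigma μ (fun ω => f (d 0 ω)) β).PosDef
  smooth : ∀ i, ∀ᵐ ω ∂μ, ∀ β ∈ B, ∀ k, ContDiffAt ℝ 2 (fun b => f (d i ω) b k) β
  integrable_envelope : Integrable b μ
  le_envelope : ∀ᵐ ω ∂μ, ∀ β ∈ B, ∀ m : ℕ, m ≤ 2 →
    (∀ k, ‖iteratedFDeriv ℝ m (fun b' => f (d 0 ω) b' k) β‖ ≤ b ω) ∧
    (∀ k l, ‖iteratedFDeriv ℝ m (fun b' => f (d 0 ω) b' k * f (d 0 ω) b' l) β‖ ≤ b ω)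
  isUnit_info : IsUnit (infoMatrix μ (fun ω => f (d 0 ω)) β₀)

namespace RegularScore

variable {𝒳 : Type*} [MeasurableSpace 𝒳] {d : ℕ → Ω → 𝒳}
  {f : 𝒳 → EuclideanSpace ℝ (Fin q) → R → ℝ} {B : Set (EuclideanSpace ℝ (Fin q))}
  {β₀ : EuclideanSpace ℝ (Fin q)} {b : Ω → ℝ}

theorem mem (H : RegularScore μ d f B β₀ b) : β₀ ∈ B := interior_subset H.mem_interior

theorem measurable_apply (H : RegularScore μ d f B β₀ b) (i : ℕ) (k : R) :
    Measurable fun ω => f (d i ω) β₀ k :=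
  (H.measurable_score β₀ k).comp (H.measurable_data i)

theorem measurable_normalizedScore (H : RegularScore μ d f B β₀ b) (N : ℕ) :
    Measurable (normalizedScore (fun i ω => f (d i ω)) β₀ N) := by
  have h1 : ∀ i, Measurable fun ω => (WithLp.toLp 2 (f (d i ω) β₀) : EuclideanSpace ℝ R) :=
    fun i => (PiLp.continuous_toLp 2 _).measurable.comp
      (measurable_pi_lambda _ fun k => H.measurable_apply i k)
  have h2 : normalizedScore (fun i ω => f (d i ω)) β₀ N = fun ω =>
      (√(N : ℝ))⁻¹ • ∑ i ∈ Finset.range N, WithLp.toLp 2 (f (d i ω) β₀) :=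
    funext fun ω => normalizedScore_eq _ _ _ _
  rw [h2]
  fun_prop

variable [IsProbabilityMeasure μ]

theorem laws_meanScore (H : RegularScore μ d f B β₀ b) (k : R) :
    (∀ᵐ ω ∂μ, ContConvOn (fun N β => meanScore (fun i ω => f (d i ω)) N ω β k)
      (fun β => ∫ ω, f (d 0 ω) β k ∂μ) B) ∧
    (∀ᵐ ω ∂μ, ∀ N : ℕ, ∀ β ∈ B,
      DifferentiableAt ℝ (fun β => meanScore (fun i ω => f (d i ω)) N ω β k) β) ∧
    (∀ (N : ℕ) l, ∀ β ∈ B, AEMeasurable (fun ω =>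
      jacobian (meanScore (fun i ω => f (d i ω)) N ω) β k l) μ) ∧
    ∀ l, ∀ᵐ ω ∂μ, ContConvOn
      (fun N β => jacobian (meanScore (fun i ω => f (d i ω)) N ω) β k l)
      (fun β => meanDeriv μ (fun ω => f (d 0 ω)) β k l) B :=
  contConvOn_mean_of_contDiffAt (f := fun x β => f x β k) H.isCompact H.measurable_data H.indep
    H.identDistrib (fun β => H.measurable_score β k) (fun i => by
      filter_upwards [H.smooth i] with ω hω β hβ
      exact hω β hβ k) H.integrable_envelope (by
      filter_upwards [H.le_envelope] with ω hω β hβ m hm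
      exact (hω β hβ m hm).1 k)

theorem laws_sampleMoment (H : RegularScore μ d f B β₀ b) (i j : R) :
    (∀ᵐ ω ∂μ, ContConvOn (fun N β => sampleMoment (fun i ω => f (d i ω)) N ω β i j)
      (fun β => sigma μ (fun ω => f (d 0 ω)) β i j) B) ∧
    (∀ᵐ ω ∂μ, ∀ N : ℕ, ∀ β ∈ B,
      DifferentiableAt ℝ (fun β => sampleMoment (fun i ω => f (d i ω)) N ω β i j) β) ∧
    (∀ (N : ℕ) l, ∀ β ∈ B, AEMeasurable (fun ω =>
      matrixDeriv (sampleMoment (fun i ω => f (d i ω)) N ω) β l i j) μ) ∧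
    ∀ l, ∀ᵐ ω ∂μ, ContConvOn
      (fun N β => matrixDeriv (sampleMoment (fun i ω => f (d i ω)) N ω) β l i j)
      (fun β => ∫ ω, partialDeriv (fun β => f (d 0 ω) β i * f (d 0 ω) β j) l β ∂μ) B :=
  contConvOn_mean_of_contDiffAt (f := fun x β => f x β i * f x β j) H.isCompact H.measurable_data
    H.indep H.identDistrib (fun β => (H.measurable_score β i).mul (H.measurable_score β j))
    (fun k => by
      filter_upwards [H.smooth k] with ω hω β hβ
      exact (hω β hβ i).mul (hω β hβ j)) H.integrable_envelope (by
      filter_upwards [H.le_envelope] with ω hω β hβ m hm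
      exact (hω β hβ m hm).2 i j)

variable {βhat : ℕ → Ω → EuclideanSpace ℝ (Fin q)}

/-- Linearization of the estimator and of the gradient of the objective at `β₀`. -/
theorem ae_isLittleO (H : RegularScore μ d f B β₀ b)
    (hβhat : ∀ N, ∀ᵐ ω ∂μ, βhat N ω ∈ B ∧
      IsMinOn (qif (fun i ω => f (d i ω)) N ω) B (βhat N ω)) :
    ∀ᵐ ω ∂μ,
      ((fun N => (βhat N ω - β₀).ofLp + influence μ (fun ω => f (d 0 ω)) β₀ *ᵥ
          meanScore (fun i ω => f (d i ω)) N ω β₀)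
        =o[atTop] fun N => meanScore (fun i ω => f (d i ω)) N ω β₀) ∧
      ((fun N => ((2 : ℝ)⁻¹ • ((infoMatrix μ (fun ω => f (d 0 ω)) β₀)⁻¹ *
          scoreGradFactor (fun i ω => f (d i ω)) β₀ N ω)) *ᵥ
            meanScore (fun i ω => f (d i ω)) N ω β₀ -
          influence μ (fun ω => f (d 0 ω)) β₀ *ᵥ meanScore (fun i ω => f (d i ω)) N ω β₀)
        =o[atTop] fun N => meanScore (fun i ω => f (d i ω)) N ω β₀) ∧
      ∀ᶠ N in atTop, IsUnit (sampleMoment (fun i ω => f (d i ω)) N ω β₀) := by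
  filter_upwards [ae_all_iff.2 fun k => (H.laws_meanScore k).1,
    ae_all_iff.2 fun k => (H.laws_meanScore k).2.1,
    ae_all_iff.2 fun k => ae_all_iff.2 fun l => (H.laws_meanScore k).2.2.2 l,
    ae_all_iff.2 fun k => ae_all_iff.2 fun l => (H.laws_sampleMoment k l).1,
    ae_all_iff.2 fun k => ae_all_iff.2 fun l => (H.laws_sampleMoment k l).2.1,
    ae_all_iff.2 fun k => ae_all_iff.2 fun l => ae_all_iff.2 fun i =>
      (H.laws_sampleMoment k l).2.2.2 i,
    ae_all_iff.2 hβhat] with ω hG hGd hD hC hCd hC' hmin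
  have hB₀ := H.mem
  have hs := fun N β => isHermitian_sampleMoment (fun i ω => f (d i ω)) N ω β
  have hm₀ : (fun k => ∫ ω, f (d 0 ω) β₀ k ∂μ) = 0 := funext H.mean_eq_zero
  have hmin' : ∀ᶠ N in atTop, IsMinOn (fun β => meanScore (fun i ω => f (d i ω)) N ω β ⬝ᵥ
      (pinv (sampleMoment (fun i ω => f (d i ω)) N ω β) *ᵥ
        meanScore (fun i ω => f (d i ω)) N ω β)) B (βhat N ω) := by
    -- Cancelling the factor N of Q_N requires N > 0.
    filter_upwards [eventually_gt_atTop 0] with N hN β hβ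
    have h1 : (0 : ℝ) < N := Nat.cast_pos.2 hN
    exact le_of_mul_le_mul_left ((hmin N).2 hβ) h1
  have hlim := tendsto_minimizer (m := fun β k => ∫ ω, f (d 0 ω) β k ∂μ) H.isCompact hB₀ hG hC
    hs H.posDef hm₀ (fun β hβ h => H.identifiable β hβ (congrFun h)) (fun N => (hmin N).1) hmin'
  let C' : EuclideanSpace ℝ (Fin q) → Fin q → Matrix R R ℝ := fun β l => Matrix.of fun i j =>
    ∫ ω, partialDeriv (fun β => f (d 0 ω) β i * f (d 0 ω) β j) l β ∂μ
  have hC'' : ∀ l i j, ContConvOn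
      (fun N β => matrixDeriv (sampleMoment (fun i ω => f (d i ω)) N ω) β l i j)
      (fun β => C' β l i j) B := fun l i j => hC' i j l
  refine ⟨isLittleO_minimizer (m := fun β k => ∫ ω, f (d 0 ω) β k ∂μ) H.mem_interior hG hC hD hC''
    (fun N β hβ k => hGd k N β hβ) (fun N β hβ k l => hCd k l N β hβ) hs (H.posDef _ hB₀) hm₀
    H.isUnit_info hlim hmin',
    isLittleO_gradFactor (m := fun β k => ∫ ω, f (d 0 ω) β k ∂μ) hB₀ hG hC hD hC''
      (H.posDef _ hB₀) hm₀ _, ?_⟩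
  exact isUnit_eventually_of_tendsto (tendsto_pi_nhds.2 fun i => tendsto_pi_nhds.2
    fun j => hC i j _ le_rfl (fun _ => β₀) β₀ hB₀ (.of_forall fun _ => hB₀) tendsto_const_nhds)
    (H.posDef _ hB₀).isUnit

/-- The first limit supplies tightness of √N ḡ_N(β₀); the second is the limit law of the leading
term -K √N ḡ_N(β₀), with covariance KΣKᵀ = J⁻¹. -/
theorem tendstoInDistribution_normalizedScore (H : RegularScore μ d f B β₀ b) :
    TendstoInDistribution (normalizedScore (fun i ω => f (d i ω)) β₀) atTop
      (id : EuclideanSpace ℝ R → EuclideanSpace ℝ R) (fun _ => μ)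
      (multivariateGaussian 0 (sigma μ (fun ω => f (d 0 ω)) β₀)) ∧
    TendstoInDistribution (fun N ω => WithLp.toLp 2 (-influence μ (fun ω => f (d 0 ω)) β₀ *ᵥ
        (normalizedScore (fun i ω => f (d i ω)) β₀ N ω).ofLp)) atTop
      (id : EuclideanSpace ℝ (Fin q) → EuclideanSpace ℝ (Fin q)) (fun _ => μ)
      (multivariateGaussian 0 (infoMatrix μ (fun ω => f (d 0 ω)) β₀)⁻¹) := by
  have hF : Measurable fun x => (WithLp.toLp 2 (f x β₀) : EuclideanSpace ℝ R) :=
    (PiLp.continuous_toLp 2 _).measurable.comp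
      (measurable_pi_lambda _ fun k => H.measurable_score β₀ k)
  let X : ℕ → Ω → EuclideanSpace ℝ R := fun i ω => WithLp.toLp 2 (f (d i ω) β₀)
  have hX : ∀ i, Measurable (X i) := fun i => hF.comp (H.measurable_data i)
  have hXi : iIndepFun X μ := H.indep.comp (fun _ x => WithLp.toLp 2 (f x β₀)) fun _ => hF
  have hXid : ∀ i, IdentDistrib (X i) (X 0) μ μ := fun i => (H.identDistrib i).comp hF
  -- Square integrability comes from the envelope of the diagonal entries of g gᵀ, with derivative
  -- order 0.
  have hX2 : ∀ k, MemLp (fun ω => X 0 ω k) 2 μ := fun k => by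
    refine (memLp_two_iff_integrable_sq (H.measurable_apply 0 k).aestronglyMeasurable).2 ?_
    refine H.integrable_envelope.mono'
      ((H.measurable_apply 0 k).pow_const 2).aestronglyMeasurable ?_
    filter_upwards [H.le_envelope] with ω hω
    simpa [sq] using (hω β₀ H.mem 0 (by norm_num)).2 k k
  have hS := H.posDef _ H.mem
  have hcov : ∀ k l, ∫ ω, X 0 ω k * X 0 ω l ∂μ = sigma μ (fun ω => f (d 0 ω)) β₀ k l :=
    fun k l => rfl
  have hT : normalizedScore (fun i ω => f (d i ω)) β₀ =
      fun (N : ℕ) ω => (√(N : ℝ))⁻¹ • ∑ i ∈ Finset.range N, X i ω :=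
    funext fun N => funext fun ω => normalizedScore_eq _ _ _ _
  rw [hT]
  refine ⟨tendstoInDistribution_multivariate hX hXi hXid hX2 H.mean_eq_zero hS.posSemidef hcov, ?_⟩
  have h1 := tendstoInDistribution_mulVec hX hXi hXid hX2 H.mean_eq_zero hS.posSemidef hcov
    (-influence μ (fun ω => f (d 0 ω)) β₀)
  have h2 : -influence μ (fun ω => f (d 0 ω)) β₀ * sigma μ (fun ω => f (d 0 ω)) β₀ *
      (-influence μ (fun ω => f (d 0 ω)) β₀)ᵀ = (infoMatrix μ (fun ω => f (d 0 ω)) β₀)⁻¹ := by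
    rw [Matrix.transpose_neg, Matrix.mul_neg, Matrix.neg_mul, Matrix.neg_mul, neg_neg]
    exact sandwich_eq hS H.isUnit_info
  rwa [h2] at h1

end RegularScore

end Asymptotics

/-! ### The term Z_N and the asymptotics of the estimator -/

section Asymptotics

variable {R : Type*} {q : ℕ} [Fintype R] [DecidableEq R]

/-- `J⁻¹ Z_N` in closed form, where the sample moment matrix is nonsingular. -/
theorem mulVec_zVec {Ω : Type*} {g : ℕ → Ω → EuclideanSpace ℝ (Fin q) → R → ℝ}
    {β₀ : EuclideanSpace ℝ (Fin q)} {N : ℕ} {ω : Ω}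
    (hG : ∀ k, DifferentiableAt ℝ (fun β => meanScore g N ω β k) β₀)
    (hC : ∀ i j, DifferentiableAt ℝ (fun β => sampleMoment g N ω β i j) β₀)
    (hu : IsUnit (sampleMoment g N ω β₀)) (I : Matrix (Fin q) (Fin q) ℝ) :
    I.toEuclideanLin (zVec g β₀ N ω) = WithLp.toLp 2 (((2 : ℝ)⁻¹ • (I * scoreGradFactor g β₀ N ω)) *ᵥ
      (normalizedScore g β₀ N ω).ofLp) := by
  have hs := isHermitian_sampleMoment g N ω
  have h1 : ∀ l, gradient (qif g N ω) β₀ l =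
      N * (scoreGradFactor g β₀ N ω *ᵥ meanScore g N ω β₀) l := fun l => by
    rw [gradient_apply_eq_partialDeriv, scoreGradFactor, ← partialDeriv_quadForm hG hC hs hu,
      partialDeriv, partialDeriv]
    have h2 := ((hasFDerivAt_quadForm hG hC hs hu).1.hasFDerivAt.const_mul (N : ℝ)).fderiv
    rw [show qif g N ω = fun β => (N : ℝ) * (meanScore g N ω β ⬝ᵥ
      (pinv (sampleMoment g N ω β) *ᵥ meanScore g N ω β)) from rfl, h2]
    rfl
  have h3 : (zVec g β₀ N ω).ofLp =
      ((2 : ℝ)⁻¹ * √(N : ℝ)) • (scoreGradFactor g β₀ N ω *ᵥ meanScore g N ω β₀) := by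
    ext l
    simp only [zVec, WithLp.ofLp_smul, Pi.smul_apply, smul_eq_mul, h1]
    rw [← mul_assoc, mul_inv, mul_assoc (2 : ℝ)⁻¹, inv_mul_eq_div _ (N : ℝ), Real.div_sqrt]
  rw [Matrix.toLpLin_apply, h3, normalizedScore]
  simp only [Matrix.mulVec_smul, Matrix.smul_mulVec, Matrix.mulVec_mulVec, smul_smul]
  rw [mul_comm]

namespace RegularScore

variable {Ω 𝒳 : Type*} [MeasurableSpace Ω] [MeasurableSpace 𝒳] {μ : Measure Ω} {d : ℕ → Ω → 𝒳}
  {f : 𝒳 → EuclideanSpace ℝ (Fin q) → R → ℝ} {B : Set (EuclideanSpace ℝ (Fin q))}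
  {β₀ : EuclideanSpace ℝ (Fin q)} {b : Ω → ℝ}

theorem measurableSet_isUnit (H : RegularScore μ d f B β₀ b) (N : ℕ) :
    MeasurableSet {ω | IsUnit (sampleMoment (fun i ω => f (d i ω)) N ω β₀)} := by
  have h1 : ∀ i j, Measurable fun ω => sampleMoment (fun i ω => f (d i ω)) N ω β₀ i j :=
    fun i j => (Finset.measurable_fun_sum _ fun c _ =>
      (H.measurable_apply c i).mul (H.measurable_apply c j)).const_mul _
  have h2 : Measurable fun ω => (sampleMoment (fun i ω => f (d i ω)) N ω β₀).det := by
    simp only [Matrix.det_apply']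
    exact Finset.measurable_fun_sum _ fun σ _ =>
      (Finset.measurable_fun_prod _ fun i _ => h1 _ _).const_mul _
  simp only [Matrix.isUnit_iff_isUnit_det, isUnit_iff_ne_zero]
  exact (measurableSet_eq_fun h2 measurable_const).compl

variable [IsProbabilityMeasure μ]

theorem aemeasurable_scoreGradFactor (H : RegularScore μ d f B β₀ b) (N : ℕ) (l : Fin q) (k : R) :
    AEMeasurable (fun ω => scoreGradFactor (fun i ω => f (d i ω)) β₀ N ω l k) μ := by
  refine aemeasurable_gradFactor_apply (fun k => ?_)
    (fun k l => (H.laws_meanScore k).2.2.1 N l β₀ H.mem) (fun i j => ?_)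
    (fun l i j => (H.laws_sampleMoment i j).2.2.1 N l β₀ H.mem) l k
  · exact ((Finset.measurable_fun_sum _ fun i _ => H.measurable_apply i k).const_mul _).aemeasurable
  · exact ((Finset.measurable_fun_sum _ fun c _ =>
      (H.measurable_apply c i).mul (H.measurable_apply c j)).const_mul _).aemeasurable

variable {βhat : ℕ → Ω → EuclideanSpace ℝ (Fin q)}

/-- Asymptotic normality and linear expansion of the minimizer of the quadratic inference
function. -/
theorem asymptotics (H : RegularScore μ d f B β₀ b) (hβm : ∀ N, AEMeasurable (βhat N) μ)
    (hβhat : ∀ N, ∀ᵐ ω ∂μ, βhat N ω ∈ B ∧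
      IsMinOn (qif (fun i ω => f (d i ω)) N ω) B (βhat N ω)) :
    TendstoInDistribution (fun (N : ℕ) ω => √(N : ℝ) • (βhat N ω - β₀)) atTop
        (id : EuclideanSpace ℝ (Fin q) → EuclideanSpace ℝ (Fin q)) (fun _ => μ)
        (multivariateGaussian 0 (infoMatrix μ (fun ω => f (d 0 ω)) β₀)⁻¹) ∧
      TendstoInMeasure μ
        (fun (N : ℕ) ω => √(N : ℝ) • (βhat N ω - (β₀ - (√(N : ℝ))⁻¹ •
          (infoMatrix μ (fun ω => f (d 0 ω)) β₀)⁻¹.toEuclideanLin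
            (zVec (fun i ω => f (d i ω)) β₀ N ω))))
        atTop (fun _ => 0) := by
  have hlin := H.ae_isLittleO hβhat
  obtain ⟨hT, hKT⟩ := H.tendstoInDistribution_normalizedScore
  have hTm := fun N => (H.measurable_normalizedScore N).aemeasurable (μ := μ)
  have hTt := hT.isTightMeasureSet_range
  set g : ℕ → Ω → EuclideanSpace ℝ (Fin q) → R → ℝ := fun i ω => f (d i ω)
  set T := normalizedScore g β₀ with hTdef
  set K := influence μ (fun ω => f (d 0 ω)) β₀
  set I := (infoMatrix μ (fun ω => f (d 0 ω)) β₀)⁻¹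
  -- `V` is the error of the approximation by -K √N ḡ_N(β₀). `W` is the remainder of the expansion
  -- with J⁻¹ Z_N replaced by its closed form, which is almost everywhere measurable and agrees with
  -- it where the sample moment matrix is nonsingular.
  let V : ℕ → Ω → EuclideanSpace ℝ (Fin q) := fun N ω =>
    √(N : ℝ) • (βhat N ω - β₀) - WithLp.toLp 2 (-K *ᵥ (T N ω).ofLp)
  let W : ℕ → Ω → EuclideanSpace ℝ (Fin q) := fun N ω => √(N : ℝ) • (βhat N ω - β₀) +
    WithLp.toLp 2 (((2 : ℝ)⁻¹ • (I * scoreGradFactor g β₀ N ω)) *ᵥ (T N ω).ofLp)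
  have hβm' : ∀ N : ℕ, AEMeasurable (fun ω => √(N : ℝ) • (βhat N ω - β₀)) μ := fun N =>
    ((hβm N).sub_const β₀).const_smul (√(N : ℝ))
  have hVm : ∀ N, AEMeasurable (V N) μ := fun N => (hβm' N).sub (hKT.forall_aemeasurable N)
  have hWm : ∀ N, AEMeasurable (W N) μ := fun N => by
    refine (hβm' N).add ((PiLp.continuous_toLp 2 _).measurable.comp_aemeasurable
      (aemeasurable_pi_lambda _ fun l => ?_))
    simp only [Matrix.mulVec, dotProduct, Matrix.smul_apply, Matrix.mul_apply, smul_eq_mul]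
    refine Finset.aemeasurable_fun_sum _ fun k _ => AEMeasurable.mul ?_ ?_
    · exact (Finset.aemeasurable_fun_sum _ fun i _ =>
        (H.aemeasurable_scoreGradFactor N i k).const_mul _).const_mul _
    · exact (measurable_pi_apply k).comp_aemeasurable
        ((PiLp.continuous_ofLp 2 _).measurable.comp_aemeasurable (hTm N))
  have hsqrt := Asymptotics.isBigO_refl (fun N : ℕ => √(N : ℝ)) atTop
  have hV0 : TendstoInMeasure μ V atTop fun _ => 0 := by
    refine tendstoInMeasure_of_isLittleO hVm hTm hTt ?_
    filter_upwards [hlin] with ω hω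
    refine (isLittleO_toLp (hsqrt.smul_isLittleO hω.1)).congr_left fun N => ?_
    ext l
    simp [V, hTdef, normalizedScore, Matrix.mulVec_smul, Matrix.neg_mulVec]
    ring
  have hW0 : TendstoInMeasure μ W atTop fun _ => 0 := by
    refine tendstoInMeasure_of_isLittleO hWm hTm hTt ?_
    filter_upwards [hlin] with ω hω
    -- The terms with K cancel when the two linearizations are added.
    refine (isLittleO_toLp (hsqrt.smul_isLittleO (hω.1.add hω.2.1))).congr_left fun N => ?_
    ext l
    simp [W, hTdef, normalizedScore, Matrix.mulVec_smul]
    ring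
  refine ⟨tendstoInDistribution_of_tendstoInMeasure_sub _ _ hKT hV0 hβm', ?_⟩
  -- Almost surely the sample moment matrix is eventually nonsingular, so the indicators of the
  -- singular events tend to 0 almost surely, and hence so do their probabilities.
  have hP : Tendsto (fun N => μ {ω | IsUnit (sampleMoment g N ω β₀)}ᶜ) atTop (𝓝 0) := by
    rw [← measure_empty (μ := μ)]
    refine tendsto_measure_of_ae_tendsto_indicator_of_isFiniteMeasure atTop MeasurableSet.empty
      (fun N => (H.measurableSet_isUnit N).compl) ?_
    filter_upwards [hlin] with ω hω
    filter_upwards [hω.2.2] with N hN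
    simpa using hN
  refine tendstoInMeasure_congr_off hW0 hP ?_
  filter_upwards [eventually_gt_atTop 0] with N hN
  filter_upwards [ae_all_iff.2 fun k => (H.laws_meanScore k).2.1,
    ae_all_iff.2 fun k => ae_all_iff.2 fun l => (H.laws_sampleMoment k l).2.1] with ω hG hC hu
  have hu' : IsUnit (sampleMoment g N ω β₀) := by simpa using hu
  have hN' : √(N : ℝ) ≠ 0 := (Real.sqrt_pos.2 (Nat.cast_pos.2 hN)).ne'
  rw [mulVec_zVec (fun k => hG k N β₀ H.mem) (fun i j => hC i j N β₀ H.mem) hu',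
    sub_sub_eq_add_sub, add_sub_right_comm, smul_add, smul_inv_smul₀ hN']

end RegularScore

end Asymptotics

end QIF

/-! ### The QIF estimator as an instance of the abstract model -/

theorem mainTheorem6 {Ω : Type*} [MeasurableSpace Ω] (μ : Measure Ω) [IsProbabilityMeasure μ]
    {n q s : ℕ}
    -- inverse link, variance function, dispersion, basis matrices
    (h v : ℝ → ℝ) (hh : Measurable h) (hv : Measurable v) (φ : ℝ) (hφ : 0 < φ)
    (M : Fin s → Matrix (Fin n) (Fin n) ℝ)
    -- the data: an independent, identically distributed sample of responses and covariates
    (Y : ℕ → Ω → Fin n → ℝ) (X : ℕ → Ω → Fin n → EuclideanSpace ℝ (Fin q))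
    (hY : ∀ i, Measurable (Y i)) (hX : ∀ i, Measurable (X i))
    (hindep : iIndepFun (fun i ω => (Y i ω, X i ω)) μ)
    (hident : ∀ i, IdentDistrib (fun ω => (Y i ω, X i ω)) (fun ω => (Y 0 ω, X 0 ω)) μ μ)
    -- compact parameter space, true parameter in its interior
    (B : Set (EuclideanSpace ℝ (Fin q))) (hB : IsCompact B)
    (β₀ : EuclideanSpace ℝ (Fin q)) (hβ₀ : β₀ ∈ interior B)
    -- the regression model for the mean holds at `β₀`
    (hYint : ∀ i t, Integrable (fun ω => Y i ω t) μ)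
    (hmean : ∀ i t, μ[fun ω => Y i ω t | MeasurableSpace.comap (X i) inferInstance]
      =ᵐ[μ] fun ω => h (inner ℝ (X i ω t) β₀))
    -- the link is differentiable and the variance function positive where they are used
    (hlink : ∀ i, ∀ᵐ ω ∂μ, ∀ β ∈ B, ∀ t,
      DifferentiableAt ℝ h (inner ℝ (X i ω t) β) ∧ 0 < v (inner ℝ (X i ω t) β))
    -- the subject-specific scores
    (g : ℕ → Ω → EuclideanSpace ℝ (Fin q) → Fin s × Fin q → ℝ)
    (hg : ∀ i ω β, g i ω β = QIF.score h v φ M (Y i ω) (X i ω) β)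
    -- identifiability
    (hid : ∀ β ∈ B, (∀ k, ∫ ω, g 0 ω β k ∂μ = 0) → β = β₀)
    -- nondegenerate second moments
    (hsigma : ∀ β ∈ B, (QIF.sigma μ (g 0) β).PosDef)
    -- the scores are twice continuously differentiable (so, uniformly on the compact set `B`)
    (hsmooth : ∀ i, ∀ᵐ ω ∂μ, ∀ β ∈ B, ∀ k, ContDiffAt ℝ 2 (fun b => g i ω b k) β)
    -- the scores, their products, and the first and second derivatives of both have integrable
    -- suprema over `B`: the laws of large numbers for them hold uniformly on `B`
    (hdom : ∃ b : Ω → ℝ, Integrable b μ ∧ ∀ᵐ ω ∂μ, ∀ β ∈ B, ∀ m : ℕ, m ≤ 2 →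
      (∀ k, ‖iteratedFDeriv ℝ m (fun b' => g 0 ω b' k) β‖ ≤ b ω) ∧
      (∀ k l, ‖iteratedFDeriv ℝ m (fun b' => g 0 ω b' k * g 0 ω b' l) β‖ ≤ b ω))
    -- `J(β₀)` is nonsingular
    (hJ : IsUnit (QIF.infoMatrix μ (g 0) β₀))
    -- the QIF estimator: a (measurable) minimizer of `Q_N` over the parameter space
    (βhat : ℕ → Ω → EuclideanSpace ℝ (Fin q)) (hβm : ∀ N, AEMeasurable (βhat N) μ)
    (hβhat : ∀ N, ∀ᵐ ω ∂μ, βhat N ω ∈ B ∧ IsMinOn (QIF.qif g N ω) B (βhat N ω)) :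
    TendstoInDistribution (fun (N : ℕ) ω => √(N : ℝ) • (βhat N ω - β₀)) atTop
        (id : EuclideanSpace ℝ (Fin q) → EuclideanSpace ℝ (Fin q)) (fun _ => μ)
        (multivariateGaussian 0 (QIF.infoMatrix μ (g 0) β₀)⁻¹) ∧
      TendstoInMeasure μ
        (fun (N : ℕ) ω => √(N : ℝ) • (βhat N ω - (β₀ - (√(N : ℝ))⁻¹ •
          (QIF.infoMatrix μ (g 0) β₀)⁻¹.toEuclideanLin (QIF.zVec g β₀ N ω))))
        atTop (fun _ => 0) := by
  obtain rfl : g = fun i ω => QIF.score h v φ M (Y i ω) (X i ω) :=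
    funext fun i => funext fun ω => funext fun β => hg i ω β
  obtain ⟨b, hb, hdom⟩ := hdom
  have hB₀ := interior_subset hβ₀
  have hd : ∀ i, Measurable fun ω => (Y i ω, X i ω) := fun i => (hY i).prodMk (hX i)
  -- The envelope at derivative order 0 makes the score integrable, which is what unbiasedness
  -- requires.
  have hmean0 : ∀ k, ∫ ω, QIF.score h v φ M (Y 0 ω) (X 0 ω) β₀ k ∂μ = 0 := fun k => by
    refine QIF.integral_score_eq_zero hv φ M (hX 0) (hYint 0) (hmean 0) k ?_
    refine hb.mono' ((QIF.measurable_score hh hv φ M β₀ k).comp (hd 0)).aestronglyMeasurable ?_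
    filter_upwards [hdom] with ω hω
    simpa using (hω β₀ hB₀ 0 (by norm_num)).1 k
  have H : QIF.RegularScore μ (fun i ω => (Y i ω, X i ω))
      (fun z => QIF.score h v φ M z.1 z.2) B β₀ b :=
    ⟨hd, hindep, hident, hB, hβ₀, fun β k => QIF.measurable_score hh hv φ M β k, hmean0, hid,
      hsigma, hsmooth, hb, hdom, hJ⟩
  exact H.asymptotics hβm hβhat
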